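/- Let $M$ be an $n$-dimensional smooth manifold (Hausdorff, second countable), let $\mathcal D\subset TM$ be a smooth distribution of rank $k$, let $P,Q\subset M$ be smooth embedded submanifolds, and let $a<b$. Let $(\theta_i)_{i=1}^{n-k}$ be a time-dependent referential (local frame) of the annihilator $\mathcal D^{\mathrm o}\subset TM^*$ over an open set $A\subset\mathbb R\times M$, that is, smooth maps $\theta_i:A\to TM^*$ such that $(\theta_i(t,m))_{i=1}^{n-k}$ is a basis of $\mathcal D^{\mathrm o}_m$ for all $(t,m)\in A$; write $\theta_{(t,m)}=(\theta_1(t,m),\dots,\theta_{n-k}(t,m)):T_mM\to\mathbb R^{n-k}$. The set of all $C^1$ curves $[a,b]\to M$ is regarded as a Banach manifold in the usual way, and the following sets of curves as Banach submanifolds of it: the set $\Omega_P([a,b],M,\mathcal D)$ of the $C^1$ curves $\mu:[a,b]\to M$ with $\mu(a)\in P$ and $\mu'(t)\in\mathcal D$ for all $t\in[a,b]$; and the set $\Omega_{PQ}([a,b],M;\hat A)$ of the $C^1$ curves $\mu:[a,b]\to M$ with $\mu(a)\in P$, $\mu(b)\in Q$ and $(t,\mu(t))\in A$ for all $t\in[a,b]$.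 Define $$\Theta:\Omega_{PQ}([a,b],M;\hat A)\to C^0([a,b],\mathbb R^{n-k}),\qquad \Theta(\mu)(t)=\theta_{(t,\mu(t))}(\mu'(t)).$$ Let $\gamma:[a,b]\to M$ be a $C^1$ curve with $\gamma(a)\in P$, $\gamma(b)\in Q$, $\gamma'(t)\in\mathcal D$ and $(t,\gamma(t))\in A$ for all $t\in[a,b]$. Then $\gamma$ is regular in $\Omega_{PQ}([a,b],M,\mathcal D)$, i.e. the endpoint map $$\Omega_P([a,b],M,\mathcal D)\ni\mu\longmapsto\mu(b)\in M$$ is transverse to $Q$ at $\gamma$, if and only if $\Theta$ is a submersion at $\gamma$. Here a $C^1$ map $f$ between Banach manifolds is a submersion at $x$ if $\mathrm df_x$ is surjective and $\operatorname{Ker}(\mathrm df_x)$ has a closed complement; it is transverse at $x$ to a submanifold $\mathcal P\ni f(x)$ if $\operatorname{Im}(\mathrm df_x)+T_{f(x)}\mathcal P=T_{f(x)}\mathcal N$, where $\mathcal N$ is the target of $f$, and $\mathrm df_x^{-1}(T_{f(x)}\mathcal P)$ has a closed complement. -/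

import Mathlib

open Set Filter Topology
open scoped Manifold ContDiff

noncomputable section

namespace HorizontalCurves

/-! ### The Banach space `C¹([a,b], V)` -/

/-- The space `C¹([a,b], V)`, realized as the space of pairs `(x, x')` of continuous maps on `[a,b]`
such that `x` is differentiable with derivative `x'` (one-sided derivatives at the end points).
The norm inherited from the product is the usual `C¹` norm `max (sup ‖x‖) (sup ‖x'‖)`. -/
def C1Space (a b : ℝ) (hab : a < b) (V : Type*) [NormedAddCommGroup V] [NormedSpace ℝ V] :
    Submodule ℝ (C(Icc a b, V) × C(Icc a b, V)) where
  carrier := {x | ∀ t : Icc a b,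
    HasDerivWithinAt (IccExtend hab.le x.1) (x.2 t) (Icc a b) (t : ℝ)}
  zero_mem' := fun t => hasDerivWithinAt_const (t : ℝ) (Icc a b) (0 : V)
  add_mem' := fun {_ _} hx hy t => (hx t).add (hy t)
  smul_mem' := fun c _ hx t => (hx t).const_smul c

section Curves

variable {n : ℕ} {M : Type*} [TopologicalSpace M] [ChartedSpace (EuclideanSpace ℝ (Fin n)) M]

/-! ### Curves of class `C¹` in the manifold `M`

A curve `[a,b] → M` is given by a function `ℝ → M`, of which only the restriction to `[a,b]`
is ever used. -/

/-- The velocity `γ'(t)` of a curve `γ : [a,b] → M` (one-sided at the end points). -/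
def velocity (n : ℕ) {M : Type*} [TopologicalSpace M] [ChartedSpace (EuclideanSpace ℝ (Fin n)) M]
    (a b : ℝ) (γ : ℝ → M) (t : ℝ) : TangentSpace (𝓡 n) (γ t) :=
  mfderivWithin 𝓘(ℝ, ℝ) (𝓡 n) γ (Icc a b) t (1 : ℝ)

/-- `Ω_P([a,b], M, D)`: the `C¹` curves `[a,b] → M` that start in `P` and are horizontal,
i.e. `γ'(t) ∈ D` for all `t`. -/
def horizontalCurves (a b : ℝ) (P : Set M) (D : ∀ m : M, Submodule ℝ (TangentSpace (𝓡 n) m)) :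
    Set (ℝ → M) :=
  {γ | ContMDiffOn 𝓘(ℝ, ℝ) (𝓡 n) 1 γ (Icc a b) ∧ γ a ∈ P ∧
    ∀ t ∈ Icc a b, velocity n a b γ t ∈ D (γ t)}

/-- `Ω_{PQ}([a,b], M; Â)`: the `C¹` curves `[a,b] → M` that start in `P`, end in `Q`, and have
their graph in `A ⊆ ℝ × M`. -/
def curvesWithGraphIn (n : ℕ) {M : Type*} [TopologicalSpace M]
    [ChartedSpace (EuclideanSpace ℝ (Fin n)) M] (a b : ℝ) (P Q : Set M) (A : Set (ℝ × M)) :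
    Set (ℝ → M) :=
  {γ | ContMDiffOn 𝓘(ℝ, ℝ) (𝓡 n) 1 γ (Icc a b) ∧ γ a ∈ P ∧ γ b ∈ Q ∧
    ∀ t ∈ Icc a b, (t, γ t) ∈ A}

/-! ### The Banach manifold of `C¹` curves and its submanifolds -/

/-- A time-dependent chart of `M`: a diffeomorphism `(t, m) ↦ (t, φ_t(m))` of an open subset of
`ℝ × M` onto an open subset of `ℝ × ℝⁿ` that preserves the time coordinate. -/
structure TimeChart (n : ℕ) (M : Type*) [TopologicalSpace M]
    [ChartedSpace (EuclideanSpace ℝ (Fin n)) M] where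
  /-- the underlying homeomorphism between open sets -/
  toHomeo : OpenPartialHomeomorph (ℝ × M) (ℝ × EuclideanSpace ℝ (Fin n))
  fst_eq : ∀ p ∈ toHomeo.source, (toHomeo p).1 = p.1
  smooth : ContMDiffOn (𝓘(ℝ, ℝ).prod (𝓡 n)) 𝓘(ℝ, ℝ × EuclideanSpace ℝ (Fin n)) ∞
    toHomeo toHomeo.source
  smooth_symm : ContMDiffOn 𝓘(ℝ, ℝ × EuclideanSpace ℝ (Fin n)) (𝓘(ℝ, ℝ).prod (𝓡 n)) ∞
    toHomeo.symm toHomeo.target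

/-- A time-dependent chart induces a chart `γ ↦ (t ↦ φ_t(γ(t)))` of the Banach manifold of `C¹`
curves in `M`, with values in `C¹([a,b], ℝⁿ)`. Its domain consists of the curves whose graph lies
in the source, its image is the open set of those `x` whose graph lies in the target, and its
inverse is the map `x ↦ (t ↦ φ_t⁻¹(x(t)))` defined here.
(Every `C¹` curve lies in the domain of such a chart, and these charts form the usual atlas of
vector bundle neighbourhoods.) -/
def TimeChart.curve (e : TimeChart n M) {a b : ℝ} {hab : a < b}
    (x : C1Space a b hab (EuclideanSpace ℝ (Fin n))) (t : ℝ) : M :=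
  (e.toHomeo.symm (t, IccExtend hab.le x.1.1 t)).2

/-- The image of a set `S` of curves under the chart of the manifold of curves induced by `e`. -/
def TimeChart.coordSet (e : TimeChart n M) {a b : ℝ} (hab : a < b) (S : Set (ℝ → M)) :
    Set (C1Space a b hab (EuclideanSpace ℝ (Fin n))) :=
  {x | (∀ t : Icc a b, ((t : ℝ), x.1.1 t) ∈ e.toHomeo.target) ∧ e.curve x ∈ S}

/-- A submanifold chart at the curve `γ` for a set `S` of curves, as a subset of the Banach
manifold of all `C¹` curves `[a,b] → M`: a chart of the manifold of curves around `γ` (induced by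
a time-dependent chart of `M`), followed by a `C¹` diffeomorphism `ψ` between open subsets of
`C¹([a,b], ℝⁿ)` which takes `S` to a complemented closed subspace `F`. -/
structure SubmanifoldChart {a b : ℝ} (hab : a < b) (S : Set (ℝ → M)) (γ : ℝ → M) where
  /-- the time-dependent chart of `M` -/
  e : TimeChart n M
  /-- the coordinate expression of the curve `γ` -/
  x : C1Space a b hab (EuclideanSpace ℝ (Fin n))
  graph_mem : ∀ t : Icc a b, ((t : ℝ), γ t) ∈ e.toHomeo.source
  x_eq : ∀ t : Icc a b, e.toHomeo ((t : ℝ), γ t) = ((t : ℝ), x.1.1 t)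
  /-- the diffeomorphism that straightens `S` -/
  ψ : OpenPartialHomeomorph (C1Space a b hab (EuclideanSpace ℝ (Fin n)))
    (C1Space a b hab (EuclideanSpace ℝ (Fin n)))
  contDiffOn : ContDiffOn ℝ 1 ψ ψ.source
  contDiffOn_symm : ContDiffOn ℝ 1 ψ.symm ψ.target
  /-- the model space of the submanifold -/
  F : Submodule ℝ (C1Space a b hab (EuclideanSpace ℝ (Fin n)))
  isClosed : IsClosed (F : Set (C1Space a b hab (EuclideanSpace ℝ (Fin n))))
  closedComplemented : F.ClosedComplemented
  mem_source : x ∈ ψ.source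
  mem_iff : ∀ y ∈ ψ.source, y ∈ e.coordSet hab S ↔ ψ y ∈ F
  /-- the point of the model space that corresponds to `γ` -/
  base : F
  base_eq : (base : C1Space a b hab (EuclideanSpace ℝ (Fin n))) = ψ x

/-- The inverse of a submanifold chart: a local parametrization of `S` by an open subset of the
Banach space `F`. -/
def SubmanifoldChart.param {a b : ℝ} {hab : a < b} {S : Set (ℝ → M)} {γ : ℝ → M}
    (c : SubmanifoldChart (n := n) hab S γ) (y : c.F) : ℝ → M :=
  c.e.curve (c.ψ.symm y)

/-! ### Embedded submanifolds of `M`, transversality, submersions -/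

/-- The subspace `ℝʳ × {0}` of `ℝⁿ`. -/
def slice (n r : ℕ) : Submodule ℝ (EuclideanSpace ℝ (Fin n)) where
  carrier := {x | ∀ i : Fin n, r ≤ (i : ℕ) → x i = 0}
  zero_mem' := fun _ _ => rfl
  add_mem' := fun {x y} hx hy i hi => by simp [hx i hi, hy i hi]
  smul_mem' := fun c x hx i hi => by simp [hx i hi]

/-- `φ` is a smooth chart of `M` around `m` that takes `P` to `ℝʳ × {0}`. -/
def IsSliceChart (r : ℕ) (P : Set M) (m : M)
    (φ : OpenPartialHomeomorph M (EuclideanSpace ℝ (Fin n))) : Prop :=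
  φ ∈ IsManifold.maximalAtlas (𝓡 n) ∞ M ∧ m ∈ φ.source ∧
    ∀ z ∈ φ.source, z ∈ P ↔ φ z ∈ slice n r

/-- `P` is a smooth embedded submanifold of `M` of dimension `r`. -/
def IsEmbeddedSubmanifold (n r : ℕ) {M : Type*} [TopologicalSpace M]
    [ChartedSpace (EuclideanSpace ℝ (Fin n)) M] (P : Set M) : Prop :=
  r ≤ n ∧ ∀ m ∈ P, ∃ φ : OpenPartialHomeomorph M (EuclideanSpace ℝ (Fin n)), IsSliceChart r P m φ

/-- `T` is the tangent space at `m` of the `r`-dimensional embedded submanifold `P` of `M`. -/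
def IsTangentSpaceOf (r : ℕ) (P : Set M) (m : M) (T : Submodule ℝ (TangentSpace (𝓡 n) m)) : Prop :=
  ∃ φ : OpenPartialHomeomorph M (EuclideanSpace ℝ (Fin n)), IsSliceChart r P m φ ∧
    ∀ v : TangentSpace (𝓡 n) m, v ∈ T ↔
      (mfderiv (𝓡 n) 𝓘(ℝ, EuclideanSpace ℝ (Fin n)) φ m v : EuclideanSpace ℝ (Fin n)) ∈ slice n r

/-- A map `f` from (an open subset of) a Banach space `F` to `M`, of class `C¹` around `y`, is
transverse at `y` to the `r`-dimensional submanifold `Q`: the image of its differential and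
`T_{f(y)}Q` span `T_{f(y)}M`, and the inverse image of `T_{f(y)}Q` under the differential is
complemented. -/
def TransverseAt {F : Type*} [NormedAddCommGroup F] [NormedSpace ℝ F]
    (f : F → M) (y : F) (r : ℕ) (Q : Set M) : Prop :=
  ContMDiffAt 𝓘(ℝ, F) (𝓡 n) 1 f y ∧
    ∃ (T : Submodule ℝ (TangentSpace (𝓡 n) (f y))) (K : Submodule ℝ F),
      IsTangentSpaceOf r Q (f y) T ∧
      (∀ w : TangentSpace (𝓡 n) (f y), ∃ v : F, ∃ u ∈ T, mfderiv 𝓘(ℝ, F) (𝓡 n) f y v + u = w) ∧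
      (∀ v : F, v ∈ K ↔ mfderiv 𝓘(ℝ, F) (𝓡 n) f y v ∈ T) ∧ K.ClosedComplemented

/-- A map `g` between (open subsets of) Banach spaces, of class `C¹` around `y`, is a submersion
at `y`: its differential is surjective and has complemented kernel. -/
def SubmersionAt {F Y : Type*} [NormedAddCommGroup F] [NormedSpace ℝ F]
    [NormedAddCommGroup Y] [NormedSpace ℝ Y] (g : F → Y) (y : F) : Prop :=
  ContDiffAt ℝ 1 g y ∧ Function.Surjective (fderiv ℝ g y) ∧
    (LinearMap.ker (fderiv ℝ g y).toLinearMap).ClosedComplemented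

/-! ### Distributions, annihilators, and the two constraints -/

/-- `D` is a smooth distribution of rank `k` on `M`: around each point it is spanned by a frame of
`k` smooth vector fields. -/
def IsSmoothDistribution (k : ℕ) (D : ∀ m : M, Submodule ℝ (TangentSpace (𝓡 n) m))
    [IsManifold (𝓡 n) ∞ M] : Prop :=
  ∀ m₀ : M, ∃ U : Set M, IsOpen U ∧ m₀ ∈ U ∧
    ∃ X : Fin k → ∀ m : M, TangentSpace (𝓡 n) m,
      (∀ i, ContMDiffOn (𝓡 n) (𝓡 n).tangent ∞
        (fun m => (⟨m, X i m⟩ : TangentBundle (𝓡 n) M)) U) ∧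
      ∀ m ∈ U, LinearIndependent ℝ (fun i => X i m) ∧
        Submodule.span ℝ (range fun i => X i m) = D m

/-- The fibre at `m` of the annihilator `D° ⊆ TM*` of `D`. -/
def annihilator (D : ∀ m : M, Submodule ℝ (TangentSpace (𝓡 n) m)) (m : M) :
    Submodule ℝ (TangentSpace (𝓡 n) m →L[ℝ] ℝ) where
  carrier := {ℓ | ∀ v ∈ D m, ℓ v = 0}
  zero_mem' := fun _ _ => rfl
  add_mem' := fun {ℓ ℓ'} h h' v hv => by
    change ℓ v + ℓ' v = 0
    rw [h v hv, h' v hv, add_zero]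
  smul_mem' := fun c ℓ h v hv => by
    change c • ℓ v = 0
    rw [h v hv, smul_zero]

/-- `θ = (θ₁, …, θ_d)` is a time-dependent referential (local frame) of the annihilator `D°` over
the open set `A ⊆ ℝ × M`: smooth maps `θ_i : A → TM*` such that the `θ_i(t,m)` form a basis of the
fibre of `D°` at `m`, for every `(t,m) ∈ A`. -/
def IsAnnihilatorFrame {d : ℕ} (D : ∀ m : M, Submodule ℝ (TangentSpace (𝓡 n) m))
    [IsManifold (𝓡 n) ∞ M] (A : Set (ℝ × M))
    (θ : Fin d → ∀ p : ℝ × M, TangentSpace (𝓡 n) p.2 →L[ℝ] ℝ) : Prop :=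
  IsOpen A ∧
    (∀ i, ContMDiffOn (𝓘(ℝ, ℝ).prod (𝓡 n))
      ((𝓡 n).prod 𝓘(ℝ, EuclideanSpace ℝ (Fin n) →L[ℝ] ℝ)) ∞
      (fun p : ℝ × M => Bundle.TotalSpace.mk' (EuclideanSpace ℝ (Fin n) →L[ℝ] ℝ)
        (E := fun m : M => TangentSpace (𝓡 n) m →L[ℝ] Bundle.Trivial M ℝ m) p.2 (θ i p)) A) ∧
    ∀ p ∈ A, LinearIndependent ℝ (fun i => θ i p) ∧
      Submodule.span ℝ (range fun i => θ i p) = annihilator D p.2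

/-- The function `t ↦ θ_{(t, γ(t))}(γ'(t))` is continuous for every `C¹` curve `γ` whose graph lies
in the domain of `θ`. -/
theorem continuous_frameVelocity {d : ℕ} [IsManifold (𝓡 n) ∞ M] {a b : ℝ} (hab : a < b)
    {D : ∀ m : M, Submodule ℝ (TangentSpace (𝓡 n) m)} {A : Set (ℝ × M)}
    {θ : Fin d → ∀ p : ℝ × M, TangentSpace (𝓡 n) p.2 →L[ℝ] ℝ} (hθ : IsAnnihilatorFrame D A θ)
    {γ : ℝ → M} (hγ : ContMDiffOn 𝓘(ℝ, ℝ) (𝓡 n) 1 γ (Icc a b))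
    (hA : ∀ t ∈ Icc a b, (t, γ t) ∈ A) :
    Continuous (fun (t : Icc a b) (i : Fin d) =>
      θ i ((t : ℝ), γ t) (velocity n a b γ t)) := by
  have : IsManifold (𝓡 n) 1 M := IsManifold.of_le (n := ∞) (by simp)
  refine continuous_pi fun i => ?_
  have hu : UniqueMDiffOn 𝓘(ℝ, ℝ) (Icc a b) := (uniqueDiffOn_Icc hab).uniqueMDiffOn
  have hc := hγ.continuousOn.domRestrict
  have hv : Continuous fun t : Icc a b => Bundle.TotalSpace.mk' (EuclideanSpace ℝ (Fin n))
      (E := fun m : M => TangentSpace (𝓡 n) m) (γ t) (velocity n a b γ t) := by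
    have h1 := hγ.continuousOn_tangentMapWithin le_rfl hu
    have h2 : Continuous fun t : Icc a b => (⟨(t : ℝ), (1 : ℝ)⟩ : TangentBundle 𝓘(ℝ, ℝ) ℝ) :=
      (tangentBundleModelSpaceHomeomorph 𝓘(ℝ, ℝ)).symm.continuous.comp
        (continuous_subtype_val.prodMk continuous_const)
    exact h1.comp_continuous h2 fun t => t.2
  have hφ : Continuous fun t : Icc a b => Bundle.TotalSpace.mk'
      (EuclideanSpace ℝ (Fin n) →L[ℝ] ℝ)
      (E := fun m : M => TangentSpace (𝓡 n) m →L[ℝ] Bundle.Trivial M ℝ m) (γ t)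
      (θ i ((t : ℝ), γ t)) :=
    (hθ.2.1 i).continuousOn.comp_continuous (continuous_subtype_val.prodMk hc) fun t => hA t t.2
  have h := Continuous.clm_bundle_apply (𝕜 := ℝ) (E₁ := fun m : M => TangentSpace (𝓡 n) m)
    (E₂ := Bundle.Trivial M ℝ) (F₂ := ℝ) (b := fun t : Icc a b => γ t)
    (ϕ := fun t : Icc a b => θ i ((t : ℝ), γ t)) hφ hv
  exact ((Bundle.Trivial.homeomorphProd M ℝ).continuous.comp h).snd

open Classical in
/-- The map `Θ(γ)(t) = θ_{(t, γ(t))}(γ'(t))` with values in `C⁰([a,b], ℝᵈ)`. The formula defines a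
continuous function for every `C¹` curve `γ` with graph in the domain of `θ`
(see `continuous_frameVelocity`); other `γ` get the value `0`. -/
def constraintMap {d : ℕ} (a b : ℝ) (θ : Fin d → ∀ p : ℝ × M, TangentSpace (𝓡 n) p.2 →L[ℝ] ℝ)
    (γ : ℝ → M) : C(Icc a b, Fin d → ℝ) :=
  if h : Continuous (fun (t : Icc a b) (i : Fin d) => θ i ((t : ℝ), γ t) (velocity n a b γ t)) then
    ⟨fun t i => θ i ((t : ℝ), γ t) (velocity n a b γ t), h⟩
  else 0

/-- The horizontal curve `γ` is regular in `Ω_{PQ}([a,b], M, D)`, where `Q` has dimension `s`: the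
end point map `μ ↦ μ(b)` of the Banach manifold `Ω_P([a,b], M, D)` is transverse to `Q` at `γ`. -/
def IsRegularCurve {a b : ℝ} (hab : a < b) (P : Set M) (s : ℕ) (Q : Set M)
    (D : ∀ m : M, Submodule ℝ (TangentSpace (𝓡 n) m)) (γ : ℝ → M) : Prop :=
  ∃ c : SubmanifoldChart (n := n) hab (horizontalCurves a b P D) γ,
    TransverseAt (n := n) (fun y : c.F => c.param y b) c.base s Q

/-- `Θ : Ω_{PQ}([a,b], M; Â) → C⁰([a,b], ℝᵈ)` is a submersion at `γ`. -/
def IsSubmersionAtCurve {d : ℕ} {a b : ℝ} (hab : a < b) (P Q : Set M) (A : Set (ℝ × M))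
    (Θ : (ℝ → M) → C(Icc a b, Fin d → ℝ)) (γ : ℝ → M) : Prop :=
  ∃ c : SubmanifoldChart (n := n) hab (curvesWithGraphIn n a b P Q A) γ,
    SubmersionAt (fun y : c.F => Θ (c.param y)) c.base

end Curves

end HorizontalCurves

end

/-! In the chart of the manifold of curves induced by a time-dependent chart, curves near `γ` become
elements of the Banach space X = C¹([a,b], ℝⁿ). Three maps on X matter: G₁, the coordinates of the
initial point transverse to `P`; G₂, the coordinates of the final point transverse to `Q`; and G₃ =
Θ. Because the θᵢ cut out `D`, the horizontal curves starting in `P` are locally {G₁ = 0, G₃ = 0},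
while the curves from `P` to `Q` with graph in `A` are locally {G₁ = 0, G₂ = 0}. Let Lᵢ be the
differential of Gᵢ at the curve. Regularity says that L₂ is onto on ker L₁ ∩ ker L₃; submersivity
says that L₃ is onto on ker L₁ ∩ ker L₂, with complemented kernel. Once (L₁, L₂) and (L₁, L₃) are
known to be onto, each surjectivity says that (L₁, L₂, L₃) is onto.

The pair (L₁, L₂) is onto because an affine path has arbitrary end points. For (L₁, L₃),
`constraintMap_differentiable` gives L₃ v = β v' + B v with every β(t) surjective, so a linear
differential equation with prescribed initial value and right-hand side has to be solved;
`exists_solution_operator` does this by a bounded operator R. Complements cost nothing for G₂, whose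
target is finite dimensional; for G₃ they come from a bounded right inverse, obtained by correcting
R with finitely many directions.

Both notions assert the existence of a submanifold chart. Of the given one, only the fact that its
tangent map lands in the relevant kernel is used. The required one is built over the same
time-dependent chart by the inverse function theorem (`exists_straightening`), so that its tangent
map is the inclusion of the kernel. -/

noncomputable section

namespace HorizontalCurves

/-! ### Superposition operators on spaces of continuous maps -/

section Superposition

set_option linter.unusedSectionVars false

variable {I V W G : Type*} [TopologicalSpace I] [CompactSpace I]
  [NormedAddCommGroup V] [NormedSpace ℝ V] [NormedAddCommGroup W] [NormedSpace ℝ W]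
  [NormedAddCommGroup G] [NormedSpace ℝ G]

/-- Pointwise application of a continuous family of operators to a continuous map. -/
def applyCLM (V G : Type*) [NormedAddCommGroup V] [NormedSpace ℝ V]
    [NormedAddCommGroup G] [NormedSpace ℝ G] :
    C(I, V →L[ℝ] G) →L[ℝ] C(I, V) →L[ℝ] C(I, G) :=
  LinearMap.mkContinuous₂
    (LinearMap.mk₂ ℝ (fun (c : C(I, V →L[ℝ] G)) (v : C(I, V)) =>
      (⟨fun t => c t (v t), by fun_prop⟩ : C(I, G)))
      (fun _ _ _ => by ext; simp) (fun _ _ _ => by ext; simp)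
      (fun _ _ _ => by ext; simp) (fun _ _ _ => by ext; simp)) 1 fun c v => by
    rw [one_mul]
    refine (ContinuousMap.norm_le _ (mul_nonneg (norm_nonneg c) (norm_nonneg v))).2 fun t => ?_
    exact (c t).le_of_opNorm_le_of_le (c.norm_coe_le_norm t) (v.norm_coe_le_norm t)

@[simp]
theorem applyCLM_apply (c : C(I, V →L[ℝ] G)) (v : C(I, V)) (t : I) :
    applyCLM V G c v t = c t (v t) := rfl

open Classical in
/-- The superposition operator `z ↦ (t ↦ h (t, z t))`, with value `0` at those `z` for which the
result is not continuous. -/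
def superposition (h : I × V → W) (z : C(I, V)) : C(I, W) :=
  if hc : Continuous fun t => h (t, z t) then ⟨fun t => h (t, z t), hc⟩ else 0

theorem superposition_apply {h : I × V → W} {O : Set (I × V)} (hh : ContinuousOn h O)
    {z : C(I, V)} (hz : ∀ t, (t, z t) ∈ O) (t : I) : superposition h z t = h (t, z t) := by
  have : Continuous fun t => h (t, z t) :=
    hh.comp_continuous (f := fun t => (t, z t)) (by fun_prop) hz
  rw [superposition, dif_pos this]
  rfl

/-- On a compact space the uniform topology is the compact-open one, and `z` depends continuously on
itself through its graph map, which has to send the compact space into `O`. -/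
theorem isOpen_setOf_graph_mem {O : Set (I × V)} (hO : IsOpen O) :
    IsOpen {z : C(I, V) | ∀ t, (t, z t) ∈ O} := by
  have h1 : Continuous fun z : C(I, V) => (ContinuousMap.id I).prodMk z :=
    ContinuousMap.continuous_of_continuous_uncurry _ (by
      change Continuous fun p : C(I, V) × I => (p.2, p.1 p.2)
      fun_prop)
  have h2 := (ContinuousMap.isOpen_setOfPred_mapsTo (X := I) isCompact_univ hO).preimage h1
  convert h2 using 1
  ext z
  simp [MapsTo]

theorem continuousOn_superposition {h : I × V → W} {O : Set (I × V)} (hh : ContinuousOn h O) :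
    ContinuousOn (superposition h) {z : C(I, V) | ∀ t, (t, z t) ∈ O} := by
  rw [continuousOn_iff_continuous_domRestrict]
  refine ContinuousMap.continuous_of_continuous_uncurry _ ?_
  have h1 : Continuous fun p : {z : C(I, V) | ∀ t, (t, z t) ∈ O} × I => (p.2, p.1.1 p.2) := by
    fun_prop
  have h2 := hh.comp_continuous h1 fun p => p.1.2 p.2
  refine h2.congr fun p => ?_
  exact (superposition_apply hh p.1.2 p.2).symm

/-- The mean value inequality is applied at each `t` separately; continuity of the superposition
operator of `h'` makes the error bound uniform in `t`. -/
theorem hasFDerivAt_superposition {h : I × V → W} {h' : I × V → V →L[ℝ] W} {O : Set (I × V)}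
    (hO : IsOpen O) (hh : ContinuousOn h O) (hh' : ContinuousOn h' O)
    (hd : ∀ p ∈ O, HasFDerivAt (fun x => h (p.1, x)) (h' p) p.2) {z : C(I, V)}
    (hz : ∀ t, (t, z t) ∈ O) :
    HasFDerivAt (superposition h) (applyCLM V W (superposition h' z)) z := by
  rw [hasFDerivAt_iff_isLittleO_nhds_zero, Asymptotics.isLittleO_iff]
  intro ε hε
  have hU := isOpen_setOf_graph_mem (V := V) hO
  have hc := (continuousOn_superposition hh').continuousAt (hU.mem_nhds hz)
  obtain ⟨δ, hδ, hball⟩ := Metric.eventually_nhds_iff.1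
    ((hU.eventually_mem hz).and (hc.eventually (Metric.ball_mem_nhds _ hε)))
  filter_upwards [Metric.ball_mem_nhds (0 : C(I, V)) hδ] with v hv
  rw [mem_ball_zero_iff] at hv
  refine (ContinuousMap.norm_le _ (by positivity)).2 fun t => ?_
  have hzv : ∀ s, (s, (z + v) s) ∈ O := (hball (by simpa [dist_eq_norm] using hv)).1
  have key : ∀ u ∈ Metric.ball (z t) δ, (t, u) ∈ O ∧ ‖h' (t, u) - h' (t, z t)‖ ≤ ε := by
    intro u hu
    -- Translating `z` by a constant gives a map close to `z` that takes the value `u` at `t`, so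
    -- the uniform bound on operators yields the pointwise bound at `u`.
    set w : C(I, V) := z + ContinuousMap.const I (u - z t) with hw
    have hwt : w t = u := by simp [hw]
    have hdist : dist w z < δ := by
      rw [dist_eq_norm, hw, add_sub_cancel_left]
      refine lt_of_le_of_lt ((ContinuousMap.norm_le _ (norm_nonneg (u - z t))).2 fun s => le_rfl) ?_
      simpa [dist_eq_norm] using hu
    obtain ⟨h1, h2⟩ := hball hdist
    refine ⟨by simpa [hwt] using h1 t, ?_⟩
    have h3 := (ContinuousMap.dist_apply_le_dist (f := superposition h' w)
      (g := superposition h' z) t).trans (Metric.mem_ball.1 h2).le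
    rwa [superposition_apply hh' h1, superposition_apply hh' hz, hwt, dist_eq_norm] at h3
  have hmv := (convex_ball (z t) δ).norm_image_sub_le_of_norm_hasFDerivWithin_le'
    (f := fun x => h (t, x)) (f' := fun x => h' (t, x)) (φ := h' (t, z t)) (C := ε)
    (fun u hu => (hd (t, u) (key u hu).1).hasFDerivWithinAt) (fun u hu => (key u hu).2)
    (Metric.mem_ball_self hδ) (y := z t + v t)
    (by simpa [Metric.mem_ball, dist_eq_norm] using (v.norm_coe_le_norm t).trans_lt hv)
  simp only [ContinuousMap.sub_apply, applyCLM_apply]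
  rw [superposition_apply hh hzv, superposition_apply hh hz, superposition_apply hh' hz]
  rw [add_sub_cancel_left] at hmv
  exact hmv.trans (mul_le_mul_of_nonneg_left (v.norm_coe_le_norm t) hε.le)

theorem contDiffAt_superposition {h : I × V → W} {h' : I × V → V →L[ℝ] W} {O : Set (I × V)}
    (hO : IsOpen O) (hh : ContinuousOn h O) (hh' : ContinuousOn h' O)
    (hd : ∀ p ∈ O, HasFDerivAt (fun x => h (p.1, x)) (h' p) p.2) {z : C(I, V)}
    (hz : ∀ t, (t, z t) ∈ O) : ContDiffAt ℝ 1 (superposition h) z :=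
  contDiffAt_one_iff.2 ⟨fun z => applyCLM V W (superposition h' z), _,
    (isOpen_setOf_graph_mem hO).mem_nhds hz,
    (applyCLM V W).continuous.comp_continuousOn (continuousOn_superposition hh'),
    fun _ hx => hasFDerivAt_superposition hO hh hh' hd hx⟩

end Superposition

/-- The unit 1 - (-K)^m factors as 1 + K times a geometric sum; the factors commute, so each of them
is a unit. -/
theorem isUnit_one_add_of_norm_pow_lt_one {R : Type*} [NormedRing R] [CompleteSpace R] {K : R}
    {m : ℕ} (hm : ‖K ^ m‖ < 1) : IsUnit (1 + K) := by
  have hm' : ‖(-K) ^ m‖ < 1 := by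
    rw [neg_pow]
    rcases neg_one_pow_eq_or R m with h | h <;> rw [h] <;> simpa
  have hu : IsUnit (1 - (-K) ^ m) := isUnit_one_sub_of_norm_lt_one hm'
  rw [← mul_neg_geom_sum] at hu
  have hcomm : Commute (1 - -K) (∑ i ∈ Finset.range m, (-K) ^ i) :=
    Commute.sum_right _ _ _ fun i _ => ((Commute.one_left _).sub_left (Commute.refl _)).pow_right i
  simpa using (hcomm.isUnit_mul_iff.1 hu).1

/-! ### Primitives and linear differential equations -/

section Primitive

variable {a b : ℝ} (hab : a < b) {V Y : Type*} [NormedAddCommGroup V] [NormedSpace ℝ V]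
  [NormedAddCommGroup Y] [NormedSpace ℝ Y]

/-- The left end point of `[a,b]`. -/
abbrev leftPt {a b : ℝ} (hab : a < b) : Icc a b := ⟨a, left_mem_Icc.2 hab.le⟩

/-- The right end point of `[a,b]`. -/
abbrev rightPt {a b : ℝ} (hab : a < b) : Icc a b := ⟨b, right_mem_Icc.2 hab.le⟩

omit [NormedSpace ℝ V] in
theorem continuous_extend (u : C(Icc a b, V)) : Continuous (IccExtend hab.le u) :=
  u.continuous.Icc_extend'

theorem hasDerivAt_integral_extend [CompleteSpace V] (u : C(Icc a b, V)) (t : ℝ) :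
    HasDerivAt (fun t => ∫ s in a..t, IccExtend hab.le u s) (IccExtend hab.le u t) t :=
  ((continuous_extend hab u).integral_hasStrictDerivAt a t).hasDerivAt

theorem norm_integral_extend_le (u : C(Icc a b, V)) (t : Icc a b) :
    ‖∫ s in a..(t : ℝ), IccExtend hab.le u s‖ ≤ (b - a) * ‖u‖ := by
  have h := intervalIntegral.norm_integral_le_of_norm_le_const (a := a) (b := (t : ℝ))
    (f := IccExtend hab.le u) (C := ‖u‖) fun s _ => u.norm_coe_le_norm _
  rw [abs_of_nonneg (sub_nonneg.2 t.2.1)] at h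
  rw [mul_comm]
  exact h.trans (mul_le_mul_of_nonneg_left (sub_le_sub_right t.2.2 a) (norm_nonneg u))

/-- The primitive `t ↦ ∫_a^t u` of a continuous map `u` on `[a,b]`. -/
def primitive (V : Type*) [NormedAddCommGroup V] [NormedSpace ℝ V] [CompleteSpace V] :
    C(Icc a b, V) →L[ℝ] C(Icc a b, V) :=
  LinearMap.mkContinuous
    { toFun := fun u => ⟨fun t => ∫ s in a..(t : ℝ), IccExtend hab.le u s,
        (continuous_iff_continuousAt.2 fun t =>
          (hasDerivAt_integral_extend hab u t).continuousAt).comp continuous_subtype_val⟩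
      map_add' := fun u v => by
        ext t
        exact intervalIntegral.integral_add ((continuous_extend hab u).intervalIntegrable _ _)
          ((continuous_extend hab v).intervalIntegrable _ _)
      map_smul' := fun c u => by
        ext t
        exact intervalIntegral.integral_smul c _ }
    (b - a) fun u => (ContinuousMap.norm_le _
      (mul_nonneg (sub_nonneg.2 hab.le) (norm_nonneg u))).2 fun t => norm_integral_extend_le hab u t

variable [CompleteSpace V]

theorem primitive_apply (u : C(Icc a b, V)) (t : Icc a b) :
    primitive hab V u t = ∫ s in a..(t : ℝ), IccExtend hab.le u s := rfl

theorem primitive_left (u : C(Icc a b, V)) : primitive hab V u (leftPt hab) = 0 := by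
  simp [primitive_apply]

/-- The fundamental theorem of calculus, in both directions. The integral form is a closed
condition, and it is the form in which solutions of differential equations are produced. -/
theorem mem_C1Space_iff (x : C(Icc a b, V) × C(Icc a b, V)) :
    x ∈ C1Space a b hab V ↔
      x.1 = ContinuousMap.const _ (x.1 (leftPt hab)) + primitive hab V x.2 := by
  constructor
  · intro hx
    ext t
    have h := intervalIntegral.integral_eq_sub_of_hasDerivAt_of_le t.2.1
      (f := IccExtend hab.le x.1) (f' := IccExtend hab.le x.2)
      (continuous_extend hab x.1).continuousOn (fun s hs => ?_)
      ((continuous_extend hab x.2).intervalIntegrable _ _)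
    · simp only [ContinuousMap.add_apply, ContinuousMap.const_apply, primitive_apply, h,
        IccExtend_val]
      rw [IccExtend_of_le_left _ _ le_rfl, add_sub_cancel]
    · have hs' : s ∈ Icc a b := ⟨hs.1.le, hs.2.le.trans t.2.2⟩
      have h1 := (hx ⟨s, hs'⟩).hasDerivAt (Icc_mem_nhds hs.1 (hs.2.trans_le t.2.2))
      rwa [IccExtend_of_mem _ _ hs']
  · intro hx t
    have h1 := ((hasDerivAt_integral_extend hab x.2 t).const_add
      (x.1 (leftPt hab))).hasDerivWithinAt (s := Icc a b)
    rw [IccExtend_val] at h1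
    have h2 : ∀ s ∈ Icc a b, IccExtend hab.le x.1 s
        = x.1 (leftPt hab) + ∫ s in a..s, IccExtend hab.le x.2 s := by
      intro s hs
      rw [IccExtend_of_mem _ _ hs]
      exact DFunLike.congr_fun hx ⟨s, hs⟩
    exact h1.congr h2 (h2 t t.2)

theorem isClosed_C1Space : IsClosed (C1Space a b hab V : Set (C(Icc a b, V) × C(Icc a b, V))) := by
  have h1 : Continuous fun x : C(Icc a b, V) × C(Icc a b, V) =>
      ContinuousMap.const (Icc a b) (x.1 (leftPt hab)) :=
    ContinuousMap.continuous_const'.comp ((continuous_eval_const (leftPt hab)).comp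
      continuous_fst)
  have h := isClosed_eq (continuous_fst (X := C(Icc a b, V)) (Y := C(Icc a b, V)))
    (h1.add ((primitive hab V).continuous.comp continuous_snd))
  convert h using 1
  ext x
  exact mem_C1Space_iff hab x

/-- Completeness is what the inverse function theorem in this space requires. -/
instance : CompleteSpace (C1Space a b hab V) := (isClosed_C1Space hab).completeSpace_coe

/-- Each iteration integrates the previous bound from `a` to `t`, which raises the power of `t - a`
and supplies the next factor of the factorial. -/
theorem norm_volterra_pow_le (c : C(Icc a b, V →L[ℝ] V)) (m : ℕ) (u : C(Icc a b, V))
    (t : Icc a b) :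
    ‖((primitive hab V ∘L applyCLM V V c) ^ m) u t‖
      ≤ ‖c‖ ^ m * ((t : ℝ) - a) ^ m / m.factorial * ‖u‖ := by
  induction m generalizing t with
  | zero => simpa using u.norm_coe_le_norm t
  | succ m ih =>
    rw [pow_succ']
    set w := ((primitive hab V ∘L applyCLM V V c) ^ m) u with hw
    change ‖∫ s in a..(t : ℝ), IccExtend hab.le (applyCLM V V c w) s‖ ≤ _
    have hint : ∫ s in a..(t : ℝ), ‖c‖ * (‖c‖ ^ m * (s - a) ^ m / m.factorial * ‖u‖)
        = ‖c‖ ^ (m + 1) * ((t : ℝ) - a) ^ (m + 1) / (m + 1).factorial * ‖u‖ := by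
      have h1 : ∀ s : ℝ, ‖c‖ * (‖c‖ ^ m * (s - a) ^ m / m.factorial * ‖u‖)
          = (‖c‖ ^ (m + 1) / m.factorial * ‖u‖) * (s - a) ^ m := fun s => by ring
      simp_rw [h1]
      rw [intervalIntegral.integral_const_mul,
        intervalIntegral.integral_comp_sub_right (fun s => s ^ m), integral_pow]
      rw [Nat.factorial_succ]
      push_cast
      have : (m.factorial : ℝ) ≠ 0 := by positivity
      have : (m + 1 : ℝ) ≠ 0 := by positivity
      field_simp
      simp
    rw [← hint]
    refine intervalIntegral.norm_integral_le_of_norm_le t.2.1 (Eventually.of_forall fun s hs => ?_)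
      (by apply Continuous.intervalIntegrable; fun_prop)
    have hs' : s ∈ Icc a b := ⟨hs.1.le, hs.2.trans t.2.2⟩
    rw [IccExtend_of_mem _ _ hs']
    exact (c _).le_of_opNorm_le_of_le (c.norm_coe_le_norm _) (ih ⟨s, hs'⟩)

/-- The factorial beats the geometric growth, so some power of the Volterra operator is a
contraction, however long the interval is. -/
theorem isUnit_one_add_volterra (c : C(Icc a b, V →L[ℝ] V)) :
    IsUnit (1 + primitive hab V ∘L applyCLM V V c) := by
  set K := primitive hab V ∘L applyCLM V V c with hK
  have hle : ∀ m : ℕ, ‖K ^ m‖ ≤ (‖c‖ * (b - a)) ^ m / m.factorial := by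
    intro m
    have hba := sub_nonneg.2 hab.le
    refine ContinuousLinearMap.opNorm_le_bound _ (by positivity) fun u => ?_
    refine (ContinuousMap.norm_le _ (by positivity)).2 fun t => ?_
    refine (norm_volterra_pow_le hab c m u t).trans ?_
    rw [mul_pow]
    have h1 : 0 ≤ (t : ℝ) - a := sub_nonneg.2 t.2.1
    have h2 : (t : ℝ) - a ≤ b - a := sub_le_sub_right t.2.2 a
    gcongr
  obtain ⟨m, hm⟩ := ((FloorSemiring.tendsto_pow_div_factorial_atTop (‖c‖ * (b - a))).eventually
    (gt_mem_nhds one_pos)).exists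
  exact isUnit_one_add_of_norm_pow_lt_one (R := C(Icc a b, V) →L[ℝ] C(Icc a b, V))
    ((hle m).trans_lt hm)

/-- The linear differential equation `β v' + B v = g`, `v(a) = v₀` has a solution that depends
linearly and continuously on `(v₀, g)`, if `β` has a continuous right inverse. -/
theorem exists_solution_operator (β B : C(Icc a b, V →L[ℝ] Y)) (ρ : C(Icc a b, Y →L[ℝ] V))
    (hρ : ∀ t y, β t (ρ t y) = y) :
    ∃ R : V × C(Icc a b, Y) →L[ℝ] C1Space a b hab V, ∀ p,
      (R p).1.1 (leftPt hab) = p.1 ∧ ∀ t, β t ((R p).1.2 t) + B t ((R p).1.1 t) = p.2 t := by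
  -- Imposing v' = ρ (g - B v) solves the equation, since β ρ = 1. Integrated, it reads (1 + K) v =
  -- v₀ + ∫ ρ g with K the Volterra operator of ρ B. Below, `S` is the solution v and `S'` is its
  -- derivative.
  let c : C(Icc a b, V →L[ℝ] V) := ⟨fun t => ρ t ∘L B t, by fun_prop⟩
  obtain ⟨U, hU⟩ := isUnit_one_add_volterra hab c
  let constL : V →L[ℝ] C(Icc a b, V) :=
    LinearMap.mkContinuous
      { toFun := fun v => ContinuousMap.const _ v
        map_add' := fun _ _ => rfl
        map_smul' := fun _ _ => rfl } 1 fun v => by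
      rw [one_mul]
      exact (ContinuousMap.norm_le _ (norm_nonneg v)).2 fun t => le_rfl
  let S : V × C(Icc a b, Y) →L[ℝ] C(Icc a b, V) :=
    (↑U⁻¹ : C(Icc a b, V) →L[ℝ] C(Icc a b, V)) ∘L
      (constL ∘L ContinuousLinearMap.fst ℝ _ _ +
        primitive hab V ∘L applyCLM Y V ρ ∘L ContinuousLinearMap.snd ℝ _ _)
  let S' : V × C(Icc a b, Y) →L[ℝ] C(Icc a b, V) :=
    applyCLM Y V ρ ∘L ContinuousLinearMap.snd ℝ _ _ - applyCLM V V c ∘L S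
  have key : ∀ p, S p = ContinuousMap.const _ p.1 + primitive hab V (S' p) := by
    intro p
    have h1 : (U : C(Icc a b, V) →L[ℝ] C(Icc a b, V)) (S p) =
        ContinuousMap.const _ p.1 + primitive hab V (applyCLM Y V ρ p.2) := by
      change ((U : C(Icc a b, V) →L[ℝ] C(Icc a b, V)) * ↑U⁻¹) _ = _
      rw [U.mul_inv]
      rfl
    rw [hU] at h1
    change S p + primitive hab V (applyCLM V V c (S p)) = _ at h1
    change S p = _ + primitive hab V (applyCLM Y V ρ p.2 - applyCLM V V c (S p))
    rw [map_sub, ← add_sub_assoc, ← h1, add_sub_cancel_right]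
  have hleft : ∀ p, S p (leftPt hab) = p.1 := fun p => by
    rw [key p, ContinuousMap.add_apply, primitive_left, add_zero, ContinuousMap.const_apply]
  refine ⟨(S.prod S').codRestrict _ fun p => (mem_C1Space_iff hab _).2 ?_, fun p => ⟨hleft p, ?_⟩⟩
  · change S p = ContinuousMap.const _ (S p (leftPt hab)) + primitive hab V (S' p)
    rw [hleft p]
    exact key p
  · intro t
    change β t (ρ t (p.2 t) - ρ t (B t (S p t))) + B t (S p t) = _
    rw [map_sub, hρ, hρ, sub_add_cancel]

end Primitive

/-- A continuous family of surjective operators from a Euclidean space to a finite dimensional space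
has a continuous family of right inverses. -/
theorem exists_continuous_rightInverse {I V Y : Type*} [TopologicalSpace I]
    [NormedAddCommGroup V] [InnerProductSpace ℝ V] [FiniteDimensional ℝ V]
    [NormedAddCommGroup Y] [NormedSpace ℝ Y] [FiniteDimensional ℝ Y] (β : C(I, V →L[ℝ] Y))
    (hβ : ∀ t, Function.Surjective (β t)) :
    ∃ ρ : C(I, Y →L[ℝ] V), ∀ t y, β t (ρ t y) = y := by
  have : CompleteSpace V := FiniteDimensional.complete ℝ V
  -- Making the target Euclidean provides adjoints. The right inverse is then β* (β β*)⁻¹: the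
  -- operator β β* is injective because β is onto, and inversion is continuous at units.
  let e := toEuclidean (E := Y)
  let W := EuclideanSpace ℝ (Fin (Module.finrank ℝ Y))
  let β' : I → V →L[ℝ] W := fun t => (e : Y →L[ℝ] W) ∘L β t
  let g : I → W →L[ℝ] W := fun t => β' t ∘L ContinuousLinearMap.adjoint (β' t)
  have hβ' : Continuous β' := by fun_prop
  have hadj : Continuous fun t => ContinuousLinearMap.adjoint (β' t) :=
    (ContinuousLinearMap.adjoint (𝕜 := ℝ) (E := V) (F := W)).continuous.comp hβ'
  have hg : Continuous g := hβ'.clm_comp hadj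
  have hunit : ∀ t, IsUnit (g t) := by
    intro t
    have hinj : Function.Injective (g t) := by
      refine (injective_iff_map_eq_zero (g t)).2 fun w hw => ?_
      have h1 : ContinuousLinearMap.adjoint (β' t) w = 0 := by
        rw [← inner_self_eq_zero (𝕜 := ℝ), ContinuousLinearMap.adjoint_inner_left]
        change inner ℝ w (g t w) = 0
        rw [hw, inner_zero_right]
      obtain ⟨v, hv⟩ := (e.surjective.comp (hβ t)) w
      change β' t v = w at hv
      rw [← inner_self_eq_zero (𝕜 := ℝ)]
      nth_rewrite 2 [← hv]
      rw [← ContinuousLinearMap.adjoint_inner_left, h1, inner_zero_left]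
    have hb : Function.Bijective (g t) :=
      ⟨hinj, LinearMap.surjective_of_injective (f := (g t).toLinearMap) hinj⟩
    exact ContinuousLinearMap.isUnit_iff_bijective.2 hb
  have hinv : Continuous fun t => Ring.inverse (g t) := by
    refine continuous_iff_continuousAt.2 fun t => ?_
    obtain ⟨u, hu⟩ := hunit t
    have h1 := NormedRing.inverse_continuousAt u
    rw [hu] at h1
    exact h1.comp hg.continuousAt
  refine ⟨⟨fun t => ContinuousLinearMap.adjoint (β' t) ∘L Ring.inverse (g t) ∘L (e : Y →L[ℝ] W),
    hadj.clm_comp (hinv.clm_comp continuous_const)⟩, fun t y => ?_⟩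
  apply e.injective
  change (g t * Ring.inverse (g t)) (e y) = e y
  rw [Ring.mul_inverse_cancel _ (hunit t)]
  rfl

/-! ### Straightening the zero set of a submersion -/

section Straightening

variable {X Y Y₁ Y₂ Y₃ F : Type*} [NormedAddCommGroup X] [NormedSpace ℝ X]
  [NormedAddCommGroup Y] [NormedSpace ℝ Y] [NormedAddCommGroup Y₁] [NormedSpace ℝ Y₁]
  [NormedAddCommGroup Y₂] [NormedSpace ℝ Y₂] [NormedAddCommGroup Y₃] [NormedSpace ℝ Y₃]
  [NormedAddCommGroup F] [NormedSpace ℝ F]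

/-- The map f = id - R L + R G has the identity as its differential at `x`, and L f = G because L R
= 1. Hence the local inverse of `f` straightens {G = 0} to ker L and is tangent to the identity. -/
theorem exists_straightening [CompleteSpace X] {G : X → Y} {L : X →L[ℝ] Y} {R : Y →L[ℝ] X} {x : X}
    {S : Set X} (hG : ContDiffAt ℝ 1 G x) (hL : HasFDerivAt G L x) (hR : ∀ y, L (R y) = y)
    (hS : ∀ᶠ y in 𝓝 x, y ∈ S ↔ G y = 0) :
    ∃ ψ : OpenPartialHomeomorph X X, x ∈ ψ.source ∧ ContDiffOn ℝ 1 ψ ψ.source ∧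
      ContDiffOn ℝ 1 ψ.symm ψ.target ∧ (∀ y ∈ ψ.source, y ∈ S ↔ ψ y ∈ L.ker) ∧
      HasFDerivAt ψ.symm (ContinuousLinearMap.id ℝ X) (ψ x) := by
  let f : X → X := fun y => y - R (L y) + R (G y)
  have hf : ContDiffAt ℝ 1 f x :=
    (contDiffAt_id.sub (R.contDiff.contDiffAt.comp x L.contDiff.contDiffAt)).add
      (R.contDiff.contDiffAt.comp x hG)
  have hf' : HasFDerivAt f (ContinuousLinearEquiv.refl ℝ X : X →L[ℝ] X) x := by
    have h := ((hasFDerivAt_id x).sub ((R.comp L).hasFDerivAt (x := x))).add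
      (R.hasFDerivAt.comp x hL)
    rw [sub_add_cancel] at h
    exact h
  have hLf : ∀ y, L (f y) = G y := fun y => by simp [f, hR]
  let ψ₀ := hf.toOpenPartialHomeomorph f hf' one_ne_zero
  have hx₀ : x ∈ ψ₀.source := hf.mem_toOpenPartialHomeomorph_source hf' one_ne_zero
  have hsymm : ContDiffAt ℝ 1 ψ₀.symm (f x) := hf.to_localInverse hf' one_ne_zero
  -- The domain is shrunk to an open set on which `f` is C¹, its inverse is C¹ at the image points,
  -- and the description of `S` holds.
  have hev : ∀ᶠ y in 𝓝 x, (y ∈ S ↔ G y = 0) ∧ ContDiffAt ℝ 1 f y ∧ ContDiffAt ℝ 1 ψ₀.symm (f y) :=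
    hS.and ((hf.eventually (by simp)).and
      (hf'.continuousAt.eventually (hsymm.eventually (by simp))))
  obtain ⟨N, hN, hNo, hxN⟩ := mem_nhds_iff.1 hev
  let ψ := ψ₀.restrOpen N hNo
  have hsource : ψ.source = ψ₀.source ∩ N := rfl
  have htarget : ∀ y ∈ ψ.target, ψ₀.symm y ∈ N ∧ f (ψ₀.symm y) = y := by
    intro y hy
    have h1 : ψ.symm y ∈ ψ.source := ψ.map_target hy
    exact ⟨h1.2, ψ.right_inv hy⟩
  refine ⟨ψ, ⟨hx₀, hxN⟩, fun y hy => (hN hy.2).2.1.contDiffWithinAt, fun y hy => ?_, fun y hy => ?_,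
    ?_⟩
  · obtain ⟨h1, h2⟩ := htarget y hy
    have h3 := (hN h1).2.2
    rw [h2] at h3
    exact h3.contDiffWithinAt
  · rw [(hN hy.2).1, LinearMap.mem_ker, ← hLf]
    rfl
  · have h := ψ₀.hasFDerivAt_symm (a := f x) (f' := ContinuousLinearEquiv.refl ℝ X)
      (ψ₀.map_source hx₀) (by
        have : ψ₀.symm (f x) = x := ψ₀.left_inv hx₀
        rw [this]
        exact hf')
    exact h

/-- A lift of `y` through `R` has the right L₁ and L₃ values; its L₂ value is cancelled by a vector
in the image of `j`, which L₁ and L₃ do not see. The correction is bounded because `Y₂` is finite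
dimensional. -/
theorem exists_rightInverse_of_surjective_restriction [FiniteDimensional ℝ Y₂]
    {L₁ : X →L[ℝ] Y₁} {L₂ : X →L[ℝ] Y₂} {L₃ : X →L[ℝ] Y₃} {R : Y₁ × Y₃ →L[ℝ] X}
    (hR₁ : ∀ p, L₁ (R p) = p.1) (hR₃ : ∀ p, L₃ (R p) = p.2) {j : F →L[ℝ] X}
    (h₁ : ∀ v, L₁ (j v) = 0) (h₃ : ∀ v, L₃ (j v) = 0) (h₂ : Function.Surjective (L₂ ∘L j)) :
    ∃ T : Y₃ →L[ℝ] X, ∀ y, L₁ (T y) = 0 ∧ L₂ (T y) = 0 ∧ L₃ (T y) = y := by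
  obtain ⟨S, hS⟩ := (L₂ ∘L j).exists_rightInverse_of_surjective (LinearMap.range_eq_top.2 h₂)
  have hS' : ∀ y, L₂ (j (S y)) = y := fun y => congr($hS y)
  let R₃ : Y₃ →L[ℝ] X := R ∘L ContinuousLinearMap.inr ℝ Y₁ Y₃
  have hR₃₁ : ∀ y, L₁ (R₃ y) = 0 := fun y => hR₁ (0, y)
  have hR₃₃ : ∀ y, L₃ (R₃ y) = y := fun y => hR₃ (0, y)
  refine ⟨R₃ - j ∘L S ∘L L₂ ∘L R₃, fun y => ⟨?_, ?_, ?_⟩⟩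
  · simp [h₁, hR₃₁]
  · simp [hS']
  · simp [h₃, hR₃₃]

/-- Start from a vector with the right L₁ and L₂ values and cancel its L₃ value by a vector in the
image of `j`, which L₁ and L₂ do not see. -/
theorem exists_mem_ker_of_surjective_restriction
    {L₁ : X →L[ℝ] Y₁} {L₂ : X →L[ℝ] Y₂} {L₃ : X →L[ℝ] Y₃}
    (h₁₂ : ∀ y, ∃ x, L₁ x = 0 ∧ L₂ x = y) {j : F →L[ℝ] X}
    (h₁ : ∀ v, L₁ (j v) = 0) (h₂ : ∀ v, L₂ (j v) = 0) (h₃ : Function.Surjective (L₃ ∘L j))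
    (y : Y₂) :
    ∃ x, L₁ x = 0 ∧ L₃ x = 0 ∧ L₂ x = y := by
  obtain ⟨x, hx₁, hx₂⟩ := h₁₂ y
  obtain ⟨v, hv⟩ := h₃ (L₃ x)
  have hv' : L₃ (j v) = L₃ x := hv
  exact ⟨x - j v, by simp [hx₁, h₁], by simp [hv'], by simp [hx₂, h₂]⟩

end Straightening

/-! ### Submanifold charts in a Banach space -/

/-- A `C¹` diffeomorphism between open subsets of the Banach space `X` that takes the set `S` to a
complemented closed subspace `F`, around the point `x` of `S`. -/
structure StraighteningChart {X : Type*} [NormedAddCommGroup X] [NormedSpace ℝ X] (S : Set X)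
    (x : X) where
  /-- the diffeomorphism -/
  ψ : OpenPartialHomeomorph X X
  contDiffOn : ContDiffOn ℝ 1 ψ ψ.source
  contDiffOn_symm : ContDiffOn ℝ 1 ψ.symm ψ.target
  /-- the model space -/
  F : Submodule ℝ X
  isClosed : IsClosed (F : Set X)
  closedComplemented : F.ClosedComplemented
  mem_source : x ∈ ψ.source
  mem_iff : ∀ y ∈ ψ.source, y ∈ S ↔ ψ y ∈ F
  /-- the point of the model space that corresponds to `x` -/
  base : F
  base_eq : (base : X) = ψ x

namespace StraighteningChart

variable {X Y Y₁ Y₂ Y₃ : Type*} [NormedAddCommGroup X] [NormedSpace ℝ X]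
  [NormedAddCommGroup Y] [NormedSpace ℝ Y] [NormedAddCommGroup Y₁] [NormedSpace ℝ Y₁]
  [NormedAddCommGroup Y₂] [NormedSpace ℝ Y₂] [NormedAddCommGroup Y₃] [NormedSpace ℝ Y₃]
  {S : Set X} {x : X} (c : StraighteningChart S x)

/-- The local parametrization of `S` by the model space. -/
def param (y : c.F) : X := c.ψ.symm y

theorem param_base : c.param c.base = x := by
  rw [param, c.base_eq, c.ψ.left_inv c.mem_source]

theorem base_mem_target : (c.base : X) ∈ c.ψ.target := by
  rw [c.base_eq]
  exact c.ψ.map_source c.mem_source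

theorem contDiffAt_symm : ContDiffAt ℝ 1 c.ψ.symm c.base :=
  c.contDiffOn_symm.contDiffAt (c.ψ.open_target.mem_nhds c.base_mem_target)

theorem contDiffAt_param : ContDiffAt ℝ 1 c.param c.base :=
  ContDiffAt.comp (f := c.F.subtypeL) c.base c.contDiffAt_symm c.F.subtypeL.contDiff.contDiffAt

/-- The differential at the base point of the local parametrization. -/
def tangentMap : c.F →L[ℝ] X := fderiv ℝ c.ψ.symm c.base ∘L c.F.subtypeL

theorem hasFDerivAt_param : HasFDerivAt c.param c.tangentMap c.base :=
  HasFDerivAt.comp (f := c.F.subtypeL) c.base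
    (c.contDiffAt_symm.differentiableAt one_ne_zero).hasFDerivAt c.F.subtypeL.hasFDerivAt

theorem tendsto_param : Tendsto c.param (𝓝 c.base) (𝓝 x) := by
  have h := c.hasFDerivAt_param.continuousAt
  rwa [ContinuousAt, c.param_base] at h

theorem hasFDerivAt_comp {G : X → Y} {L : X →L[ℝ] Y} (hL : HasFDerivAt G L x) :
    HasFDerivAt (fun y : c.F => G (c.param y)) (L ∘L c.tangentMap) c.base := by
  have h : HasFDerivAt G L (c.param c.base) := by rwa [c.param_base]
  exact h.comp c.base c.hasFDerivAt_param

theorem contDiffAt_comp {G : X → Y} (hG : ContDiffAt ℝ 1 G x) :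
    ContDiffAt ℝ 1 (fun y : c.F => G (c.param y)) c.base := by
  have h : ContDiffAt ℝ 1 G (c.param c.base) := by rwa [c.param_base]
  exact h.comp c.base c.contDiffAt_param

theorem contMDiffAt_comp {n : ℕ} {M : Type*} [TopologicalSpace M]
    [ChartedSpace (EuclideanSpace ℝ (Fin n)) M] {f : X → M}
    (hf : ContMDiffAt 𝓘(ℝ, X) (𝓡 n) 1 f x) :
    ContMDiffAt 𝓘(ℝ, c.F) (𝓡 n) 1 (fun y : c.F => f (c.param y)) c.base := by
  have h : ContMDiffAt 𝓘(ℝ, X) (𝓡 n) 1 f (c.param c.base) := by rwa [c.param_base]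
  exact h.comp c.base c.contDiffAt_param.contMDiffAt

theorem eventually_param_mem : ∀ᶠ y : c.F in 𝓝 c.base, c.param y ∈ S := by
  have h : ∀ᶠ y : c.F in 𝓝 c.base, (y : X) ∈ c.ψ.target :=
    c.F.subtypeL.continuous.continuousAt.eventually
      (c.ψ.open_target.eventually_mem c.base_mem_target)
  filter_upwards [h] with y hy
  rw [param, c.mem_iff _ (c.ψ.map_target hy), c.ψ.right_inv hy]
  exact y.2

/-- The parametrization stays in `S`, so `G` vanishes identically along it near the base point. This
controls an arbitrary chart of `S`, whose tangent map is otherwise unknown. -/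
theorem apply_tangentMap_eq_zero {G : X → Y} {L : X →L[ℝ] Y} (hL : HasFDerivAt G L x)
    (hS : ∀ᶠ y in 𝓝 x, y ∈ S → G y = 0) (v : c.F) : L (c.tangentMap v) = 0 := by
  have h1 : (fun y : c.F => G (c.param y)) =ᶠ[𝓝 c.base] fun _ => (0 : Y) := by
    filter_upwards [c.tendsto_param.eventually hS, c.eventually_param_mem] with y hy hy'
    exact hy hy'
  have h2 := (c.hasFDerivAt_comp hL).unique
    ((hasFDerivAt_const (0 : Y) c.base).congr_of_eventuallyEq h1)
  exact congr($h2 v)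

theorem exists_of_submersion [CompleteSpace X] {G : X → Y} {L : X →L[ℝ] Y} {R : Y →L[ℝ] X}
    (hG : ContDiffAt ℝ 1 G x) (hL : HasFDerivAt G L x) (hR : ∀ y, L (R y) = y)
    (hxS : x ∈ S) (hS : ∀ᶠ y in 𝓝 x, y ∈ S ↔ G y = 0) :
    ∃ c : StraighteningChart S x, (∀ v, v ∈ c.F ↔ L v = 0) ∧ ∀ v : c.F, c.tangentMap v = v := by
  obtain ⟨ψ, hx, h1, h2, h3, h4⟩ := exists_straightening hG hL hR hS
  refine ⟨⟨ψ, h1, h2, L.ker, L.isClosed_ker,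
    L.closedComplemented_ker_of_rightInverse R hR, hx, h3, ⟨ψ x, (h3 x hx).1 hxS⟩, rfl⟩,
    fun v => LinearMap.mem_ker, fun v => ?_⟩
  change fderiv ℝ ψ.symm (ψ x) v = v
  rw [h4.fderiv]
  rfl

section Exchange

variable [CompleteSpace X] {S' : Set X} {G₁ : X → Y₁} {G₂ : X → Y₂} {G₃ : X → Y₃}
  {L₁ : X →L[ℝ] Y₁} {L₂ : X →L[ℝ] Y₂} {L₃ : X →L[ℝ] Y₃}

/-- If `G₂` is a submersion on `{G₁ = 0, G₃ = 0}`, then `G₃` is a submersion on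
`{G₁ = 0, G₂ = 0}`. -/
theorem exists_submersionAt [FiniteDimensional ℝ Y₁] [FiniteDimensional ℝ Y₂]
    (h₁ : HasFDerivAt G₁ L₁ x) (h₂ : HasFDerivAt G₂ L₂ x) (h₃ : HasFDerivAt G₃ L₃ x)
    (hG₁ : ContDiffAt ℝ 1 G₁ x) (hG₂ : ContDiffAt ℝ 1 G₂ x) (hG₃ : ContDiffAt ℝ 1 G₃ x)
    {R : Y₁ × Y₃ →L[ℝ] X} (hR₁ : ∀ p, L₁ (R p) = p.1) (hR₃ : ∀ p, L₃ (R p) = p.2)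
    (h₁₂ : Function.Surjective (L₁.prod L₂)) (hxS' : x ∈ S')
    (hS : ∀ᶠ y in 𝓝 x, y ∈ S ↔ G₁ y = 0 ∧ G₃ y = 0)
    (hS' : ∀ᶠ y in 𝓝 x, y ∈ S' ↔ G₁ y = 0 ∧ G₂ y = 0)
    (hc : Function.Surjective (fderiv ℝ (fun y : c.F => G₂ (c.param y)) c.base)) :
    ∃ c' : StraighteningChart S' x, SubmersionAt (fun y : c'.F => G₃ (c'.param y)) c'.base := by
  rw [(c.hasFDerivAt_comp h₂).fderiv] at hc
  obtain ⟨T, hT⟩ := exists_rightInverse_of_surjective_restriction hR₁ hR₃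
    (c.apply_tangentMap_eq_zero h₁ (hS.mono fun y hy h => (hy.1 h).1))
    (c.apply_tangentMap_eq_zero h₃ (hS.mono fun y hy h => (hy.1 h).2)) hc
  -- Finite dimensionality of `Y₁ × Y₂` turns surjectivity into a bounded right inverse, as needed
  -- to straighten {G₁ = 0, G₂ = 0}.
  obtain ⟨R', hR'⟩ := (L₁.prod L₂).exists_rightInverse_of_surjective (LinearMap.range_eq_top.2 h₁₂)
  obtain ⟨c', hF, htan⟩ := exists_of_submersion (hG₁.prodMk hG₂) (h₁.prodMk h₂)
    (fun y => congr($hR' y)) hxS' (hS'.mono fun y hy => by rw [hy, Prod.mk_eq_zero])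
  have hT' : ∀ y, T y ∈ c'.F := fun y => (hF _).2 (by simp [hT y])
  have hright : Function.RightInverse (T.codRestrict c'.F hT') (L₃ ∘L c'.tangentMap) := fun y => by
    change L₃ (c'.tangentMap ⟨T y, hT' y⟩) = y
    rw [htan]
    exact (hT y).2.2
  refine ⟨c', c'.contDiffAt_comp hG₃, ?_⟩
  rw [(c'.hasFDerivAt_comp h₃).fderiv]
  exact ⟨hright.surjective, ContinuousLinearMap.closedComplemented_ker_of_rightInverse _ _ hright⟩

/-- If `G₃` is a submersion on `{G₁ = 0, G₂ = 0}`, then `G₂` is a submersion on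
`{G₁ = 0, G₃ = 0}`. -/
theorem exists_surjective_fderiv
    (h₁ : HasFDerivAt G₁ L₁ x) (h₂ : HasFDerivAt G₂ L₂ x) (h₃ : HasFDerivAt G₃ L₃ x)
    (hG₁ : ContDiffAt ℝ 1 G₁ x) (hG₃ : ContDiffAt ℝ 1 G₃ x)
    {R : Y₁ × Y₃ →L[ℝ] X} (hR₁ : ∀ p, L₁ (R p) = p.1) (hR₃ : ∀ p, L₃ (R p) = p.2)
    (h₁₂ : Function.Surjective (L₁.prod L₂)) (hxS' : x ∈ S')
    (hS : ∀ᶠ y in 𝓝 x, y ∈ S ↔ G₁ y = 0 ∧ G₂ y = 0)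
    (hS' : ∀ᶠ y in 𝓝 x, y ∈ S' ↔ G₁ y = 0 ∧ G₃ y = 0)
    (hc : Function.Surjective (fderiv ℝ (fun y : c.F => G₃ (c.param y)) c.base)) :
    ∃ c' : StraighteningChart S' x,
      Function.Surjective (fderiv ℝ (fun y : c'.F => G₂ (c'.param y)) c'.base) := by
  rw [(c.hasFDerivAt_comp h₃).fderiv] at hc
  obtain ⟨c', hF, htan⟩ := exists_of_submersion (hG₁.prodMk hG₃) (h₁.prodMk h₃)
    (R := R) (fun y => Prod.ext (hR₁ y) (hR₃ y)) hxS'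
    (hS'.mono fun y hy => by rw [hy, Prod.mk_eq_zero])
  refine ⟨c', fun y => ?_⟩
  obtain ⟨v, hv₁, hv₃, hv₂⟩ := exists_mem_ker_of_surjective_restriction
    (fun y => (h₁₂ (0, y)).imp fun v hv => Prod.mk.inj hv)
    (c.apply_tangentMap_eq_zero h₁ (hS.mono fun y hy h => (hy.1 h).1))
    (c.apply_tangentMap_eq_zero h₂ (hS.mono fun y hy h => (hy.1 h).2)) hc y
  refine ⟨⟨v, (hF v).2 (by simp [hv₁, hv₃])⟩, ?_⟩
  rw [(c'.hasFDerivAt_comp h₂).fderiv]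
  change L₂ (c'.tangentMap _) = y
  rw [htan]
  exact hv₂

end Exchange

end StraighteningChart

/-! ### Submanifold charts of sets of curves -/

namespace SubmanifoldChart

variable {n : ℕ} {M : Type*} [TopologicalSpace M] [ChartedSpace (EuclideanSpace ℝ (Fin n)) M]
  {a b : ℝ} {hab : a < b} {S : Set (ℝ → M)} {γ : ℝ → M}

/-- The straightening chart in coordinates that underlies a submanifold chart. -/
def toStraighteningChart (c : SubmanifoldChart (n := n) hab S γ) :
    StraighteningChart (c.e.coordSet hab S) c.x :=
  ⟨c.ψ, c.contDiffOn, c.contDiffOn_symm, c.F, c.isClosed, c.closedComplemented, c.mem_source,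
    c.mem_iff, c.base, c.base_eq⟩

/-- The submanifold chart given by a time-dependent chart and a straightening chart in
coordinates. -/
def ofStraighteningChart (e : TimeChart n M) {x : C1Space a b hab (EuclideanSpace ℝ (Fin n))}
    (graph_mem : ∀ t : Icc a b, ((t : ℝ), γ t) ∈ e.toHomeo.source)
    (x_eq : ∀ t : Icc a b, e.toHomeo ((t : ℝ), γ t) = ((t : ℝ), x.1.1 t))
    (c : StraighteningChart (e.coordSet hab S) x) : SubmanifoldChart (n := n) hab S γ :=
  ⟨e, x, graph_mem, x_eq, c.ψ, c.contDiffOn, c.contDiffOn_symm, c.F, c.isClosed,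
    c.closedComplemented, c.mem_source, c.mem_iff, c.base, c.base_eq⟩

end SubmanifoldChart

section Coordinates

variable {n : ℕ} {M : Type*} [TopologicalSpace M] [ChartedSpace (EuclideanSpace ℝ (Fin n)) M]

/-! ### Time-dependent charts -/

namespace TimeChart

variable (e : TimeChart n M)

/-- The space component of the inverse of a time-dependent chart. -/
def space (p : ℝ × EuclideanSpace ℝ (Fin n)) : M := (e.toHomeo.symm p).2

theorem fst_symm {p : ℝ × EuclideanSpace ℝ (Fin n)} (hp : p ∈ e.toHomeo.target) :
    (e.toHomeo.symm p).1 = p.1 := by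
  rw [← e.fst_eq _ (e.toHomeo.map_target hp), e.toHomeo.right_inv hp]

theorem symm_eq {p : ℝ × EuclideanSpace ℝ (Fin n)} (hp : p ∈ e.toHomeo.target) :
    e.toHomeo.symm p = (p.1, e.space p) :=
  Prod.ext (e.fst_symm hp) rfl

theorem contMDiffOn_space :
    ContMDiffOn 𝓘(ℝ, ℝ × EuclideanSpace ℝ (Fin n)) (𝓡 n) ∞ e.space e.toHomeo.target :=
  contMDiff_snd.comp_contMDiffOn e.smooth_symm

theorem contMDiffAt_space {p : ℝ × EuclideanSpace ℝ (Fin n)} (hp : p ∈ e.toHomeo.target) :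
    ContMDiffAt 𝓘(ℝ, ℝ × EuclideanSpace ℝ (Fin n)) (𝓡 n) ∞ e.space p :=
  e.contMDiffOn_space.contMDiffAt (e.toHomeo.open_target.mem_nhds hp)

theorem mdifferentiableAt_space {p : ℝ × EuclideanSpace ℝ (Fin n)} (hp : p ∈ e.toHomeo.target) :
    MDifferentiableAt 𝓘(ℝ, ℝ × EuclideanSpace ℝ (Fin n)) (𝓡 n) e.space p :=
  (e.contMDiffAt_space hp).mdifferentiableAt (by simp)

/-- At a fixed time, m ↦ φ_t(m) is inverted by `e.space`, so the differential of `e.space` is onto.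
The time component of that map is constant, so the preimage can be taken with zero time component.
-/
theorem exists_mfderiv_space_eq {p : ℝ × EuclideanSpace ℝ (Fin n)} (hp : p ∈ e.toHomeo.target)
    (v : TangentSpace (𝓡 n) (e.space p)) :
    ∃ w : EuclideanSpace ℝ (Fin n),
      mfderiv 𝓘(ℝ, ℝ × EuclideanSpace ℝ (Fin n)) (𝓡 n) e.space p ((0 : ℝ), w) = v := by
  let g : M → ℝ × EuclideanSpace ℝ (Fin n) := fun m => e.toHomeo (p.1, m)
  have hsrc : (p.1, e.space p) ∈ e.toHomeo.source := by
    rw [← e.symm_eq hp]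
    exact e.toHomeo.map_target hp
  have hgp : g (e.space p) = p := by
    change e.toHomeo (p.1, e.space p) = p
    rw [← e.symm_eq hp, e.toHomeo.right_inv hp]
  have hev : ∀ᶠ m in 𝓝 (e.space p), (p.1, m) ∈ e.toHomeo.source :=
    (continuous_const.prodMk continuous_id).continuousAt.eventually
      (e.toHomeo.open_source.eventually_mem hsrc)
  have hg : MDifferentiableAt (𝓡 n) 𝓘(ℝ, ℝ × EuclideanSpace ℝ (Fin n)) g (e.space p) := by
    have h1 : ContMDiffAt (𝓘(ℝ, ℝ).prod (𝓡 n)) 𝓘(ℝ, ℝ × EuclideanSpace ℝ (Fin n)) ∞ e.toHomeo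
        (p.1, e.space p) := e.smooth.contMDiffAt (e.toHomeo.open_source.mem_nhds hsrc)
    have h2 : ContMDiffAt (𝓡 n) (𝓘(ℝ, ℝ).prod (𝓡 n)) ∞ (fun m : M => (p.1, m)) (e.space p) :=
      contMDiffAt_const.prodMk contMDiffAt_id
    exact (h1.comp (e.space p) h2).mdifferentiableAt (by simp)
  have hid : (fun m => e.space (g m)) =ᶠ[𝓝 (e.space p)] id := by
    filter_upwards [hev] with m hm
    change (e.toHomeo.symm (e.toHomeo (p.1, m))).2 = m
    rw [e.toHomeo.left_inv hm]
  have hσ := e.mdifferentiableAt_space hp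
  have h1 := mfderiv_comp_apply_of_eq (I' := 𝓘(ℝ, ℝ × EuclideanSpace ℝ (Fin n))) (I'' := 𝓡 n)
    (e.space p) hσ hg hgp v
  have h2 : mfderiv (𝓡 n) (𝓡 n) (e.space ∘ g) (e.space p) v = v := by
    have h3 : mfderiv (𝓡 n) (𝓡 n) (e.space ∘ g) (e.space p)
        = mfderiv (𝓡 n) (𝓡 n) (id : M → M) (e.space p) := hid.mfderiv_eq
    rw [h3, mfderiv_id]
    rfl
  have h3 : (mfderiv (𝓡 n) 𝓘(ℝ, ℝ × EuclideanSpace ℝ (Fin n)) g (e.space p) v).1 = (0 : ℝ) := by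
    have hc : (fun m => (ContinuousLinearMap.fst ℝ ℝ (EuclideanSpace ℝ (Fin n))) (g m))
        =ᶠ[𝓝 (e.space p)] fun _ => p.1 := by
      filter_upwards [hev] with m hm
      exact e.fst_eq _ hm
    have hfst : MDifferentiableAt 𝓘(ℝ, ℝ × EuclideanSpace ℝ (Fin n)) 𝓘(ℝ, ℝ)
        (ContinuousLinearMap.fst ℝ ℝ (EuclideanSpace ℝ (Fin n))) (g (e.space p)) :=
      (ContinuousLinearMap.fst ℝ ℝ (EuclideanSpace ℝ (Fin n))).mdifferentiableAt
    have h4 := mfderiv_comp_apply (I' := 𝓘(ℝ, ℝ × EuclideanSpace ℝ (Fin n))) (I'' := 𝓘(ℝ, ℝ))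
      (e.space p) hfst hg v
    have h5 : mfderiv (𝓡 n) 𝓘(ℝ, ℝ)
        ((ContinuousLinearMap.fst ℝ ℝ (EuclideanSpace ℝ (Fin n))) ∘ g) (e.space p)
        = mfderiv (𝓡 n) 𝓘(ℝ, ℝ) (fun _ : M => p.1) (e.space p) := hc.mfderiv_eq
    rw [h5, mfderiv_const, ContinuousLinearMap.mfderiv_eq] at h4
    exact h4.symm
  refine ⟨(mfderiv (𝓡 n) 𝓘(ℝ, ℝ × EuclideanSpace ℝ (Fin n)) g (e.space p) v).2, ?_⟩
  have h4 : (((0 : ℝ), (mfderiv (𝓡 n) 𝓘(ℝ, ℝ × EuclideanSpace ℝ (Fin n)) g (e.space p) v).2) :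
      ℝ × EuclideanSpace ℝ (Fin n))
      = mfderiv (𝓡 n) 𝓘(ℝ, ℝ × EuclideanSpace ℝ (Fin n)) g (e.space p) v :=
    Prod.ext h3.symm rfl
  rw [h4]
  exact h1.symm.trans h2

variable {a b : ℝ} {hab : a < b}

theorem curve_eq (x : C1Space a b hab (EuclideanSpace ℝ (Fin n))) (t : ℝ) :
    e.curve x t = e.space (t, IccExtend hab.le x.1.1 t) := rfl

theorem curve_coe (x : C1Space a b hab (EuclideanSpace ℝ (Fin n))) (t : Icc a b) :
    e.curve x t = e.space ((t : ℝ), x.1.1 t) := by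
  rw [curve_eq, IccExtend_val]

theorem hasDerivWithinAt_graph (x : C1Space a b hab (EuclideanSpace ℝ (Fin n))) (t : Icc a b) :
    HasDerivWithinAt (fun s : ℝ => (s, IccExtend hab.le x.1.1 s)) ((1 : ℝ), x.1.2 t) (Icc a b) t :=
  (hasDerivWithinAt_id _ _).prodMk (x.2 t)

theorem contDiffOn_graph (x : C1Space a b hab (EuclideanSpace ℝ (Fin n))) :
    ContDiffOn ℝ 1 (fun s : ℝ => (s, IccExtend hab.le x.1.1 s)) (Icc a b) := by
  have hu := uniqueDiffOn_Icc hab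
  refine (contDiffOn_one_iff_derivWithin hu).2
    ⟨fun t ht => (hasDerivWithinAt_graph x ⟨t, ht⟩).differentiableWithinAt, ?_⟩
  have h1 : Continuous fun s : ℝ => ((1 : ℝ), IccExtend hab.le x.1.2 s) :=
    continuous_const.prodMk (continuous_extend hab x.1.2)
  refine h1.continuousOn.congr fun t ht => ?_
  rw [(hasDerivWithinAt_graph x ⟨t, ht⟩).derivWithin (hu t ht)]
  exact Prod.ext rfl (IccExtend_of_mem hab.le x.1.2 ht).symm

variable {e} in
theorem contMDiffOn_curve {x : C1Space a b hab (EuclideanSpace ℝ (Fin n))}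
    (hx : ∀ t : Icc a b, ((t : ℝ), x.1.1 t) ∈ e.toHomeo.target) :
    ContMDiffOn 𝓘(ℝ, ℝ) (𝓡 n) 1 (e.curve x) (Icc a b) := by
  refine (e.contMDiffOn_space.of_le (by simp)).comp (contDiffOn_graph x).contMDiffOn fun t ht => ?_
  simpa only [mem_preimage, IccExtend_of_mem _ _ ht] using hx ⟨t, ht⟩

variable {e} in
-- Chain rule along the graph s ↦ (s, x(s)), whose time component has speed 1. The base point is
-- kept in the `IccExtend` form so that the two tangent spaces agree definitionally.
theorem velocity_curve {x : C1Space a b hab (EuclideanSpace ℝ (Fin n))}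
    (hx : ∀ t : Icc a b, ((t : ℝ), x.1.1 t) ∈ e.toHomeo.target) (t : Icc a b) :
    velocity n a b (e.curve x) t = mfderiv 𝓘(ℝ, ℝ × EuclideanSpace ℝ (Fin n)) (𝓡 n) e.space
      ((t : ℝ), IccExtend hab.le x.1.1 t) ((1 : ℝ), x.1.2 t) := by
  have hmem : ((t : ℝ), IccExtend hab.le x.1.1 t) ∈ e.toHomeo.target := by
    rw [IccExtend_val]
    exact hx t
  have h1 := (hasDerivWithinAt_graph x t).hasFDerivWithinAt.hasMFDerivWithinAt
  have h2 := (e.mdifferentiableAt_space hmem).hasMFDerivAt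
  have h3 := HasMFDerivAt.comp_hasMFDerivWithinAt (g := e.space)
    (f := fun s : ℝ => (s, IccExtend hab.le x.1.1 s)) (t : ℝ) h2 h1
  have h4 := h3.mfderivWithin ((uniqueDiffOn_Icc hab).uniqueMDiffOn t t.2)
  change mfderivWithin 𝓘(ℝ, ℝ) (𝓡 n) (e.space ∘ fun s : ℝ => (s, IccExtend hab.le x.1.1 s))
    (Icc a b) t (1 : ℝ) = _
  rw [h4]
  change mfderiv 𝓘(ℝ, ℝ × EuclideanSpace ℝ (Fin n)) (𝓡 n) e.space
    ((t : ℝ), IccExtend hab.le x.1.1 t) ((1 : ℝ) • ((1 : ℝ), x.1.2 t)) = _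
  rw [one_smul]

end TimeChart

end Coordinates

/-! ### Linear forms: independence and annihilators -/

section LinearForms

variable {V : Type*} [NormedAddCommGroup V] [NormedSpace ℝ V] {d : ℕ} {f : Fin d → V →L[ℝ] ℝ}

/-- If the joint values did not fill ℝᵈ, a nonzero functional would kill them all, and its
coefficients would be a linear relation between the forms. -/
theorem exists_forall_apply_eq (hf : LinearIndependent ℝ f) (y : Fin d → ℝ) :
    ∃ v, ∀ i, f i v = y i := by
  let F : V →ₗ[ℝ] (Fin d → ℝ) := LinearMap.pi fun i => (f i).toLinearMap
  suffices h : LinearMap.range F = ⊤ by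
    obtain ⟨v, hv⟩ := LinearMap.range_eq_top.1 h y
    exact ⟨v, fun i => congr_fun hv i⟩
  by_contra h
  obtain ⟨φ, hφ, hle⟩ := Submodule.exists_le_ker_of_lt_top _ (lt_top_iff_ne_top.2 h)
  have hsum : ∀ z : Fin d → ℝ, φ z = ∑ i, φ (Pi.single i 1) * z i := fun z => by
    conv_lhs => rw [pi_eq_sum_univ' z]
    simp [mul_comm]
  have h0 : ∑ i, φ (Pi.single i 1) • f i = 0 := by
    ext v
    have h1 : φ (F v) = 0 := hle ⟨v, rfl⟩
    rw [hsum] at h1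
    simpa [F] using h1
  have h1 := Fintype.linearIndependent_iff.1 hf _ h0
  exact hφ (LinearMap.ext fun z => by simp [hsum z, h1])

/-- A vector outside `D` is detected by a functional vanishing on `D`, continuous by finite
dimensionality; this functional is a combination of the `f i`. -/
theorem mem_iff_forall_apply_eq_zero [FiniteDimensional ℝ V] {D : Submodule ℝ V}
    (hf : ∀ ℓ, ℓ ∈ Submodule.span ℝ (range f) ↔ ∀ v ∈ D, ℓ v = 0) (v : V) :
    v ∈ D ↔ ∀ i, f i v = 0 := by
  refine ⟨fun hv i => (hf (f i)).1 (Submodule.subset_span ⟨i, rfl⟩) v hv, fun hv => ?_⟩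
  by_contra h
  obtain ⟨φ, hφ, hle⟩ := Submodule.exists_le_ker_of_notMem h
  have hspan : LinearMap.toContinuousLinearMap φ ∈ Submodule.span ℝ (range f) :=
    (hf _).2 fun w hw => hle hw
  have hker : Submodule.span ℝ (range f) ≤
      LinearMap.ker (ContinuousLinearMap.apply ℝ ℝ v).toLinearMap := by
    rw [Submodule.span_le]
    rintro _ ⟨i, rfl⟩
    exact hv i
  exact hφ (hker hspan)

end LinearForms

/-! ### The frame and the constraint in a time-dependent chart -/

section Constraint

variable {n d : ℕ} {M : Type*} [TopologicalSpace M] [ChartedSpace (EuclideanSpace ℝ (Fin n)) M]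
  {D : ∀ m : M, Submodule ℝ (TangentSpace (𝓡 n) m)} {A : Set (ℝ × M)}
  {θ : Fin d → ∀ p : ℝ × M, TangentSpace (𝓡 n) p.2 →L[ℝ] ℝ}
  {a b : ℝ} {hab : a < b} (e : TimeChart n M)

namespace TimeChart

/-- The coordinate expression of the frame: the operator `(τ, w) ↦ θ (dσ (τ, w))`, where `σ` is the
space component of the inverse of the time-dependent chart. -/
def frame (θ : Fin d → ∀ p : ℝ × M, TangentSpace (𝓡 n) p.2 →L[ℝ] ℝ)
    (p : ℝ × EuclideanSpace ℝ (Fin n)) : (ℝ × EuclideanSpace ℝ (Fin n)) →L[ℝ] (Fin d → ℝ) :=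
  ContinuousLinearMap.pi fun i => (θ i (p.1, e.space p)).comp
    (mfderiv 𝓘(ℝ, ℝ × EuclideanSpace ℝ (Fin n)) (𝓡 n) e.space p)

theorem frame_apply (p u : ℝ × EuclideanSpace ℝ (Fin n)) (i : Fin d) :
    e.frame θ p u i = θ i (p.1, e.space p)
      (mfderiv 𝓘(ℝ, ℝ × EuclideanSpace ℝ (Fin n)) (𝓡 n) e.space p u) := rfl

/-- The coordinate expression of an open subset `A` of `ℝ × M`. -/
def coordOpen (A : Set (ℝ × M)) : Set (ℝ × EuclideanSpace ℝ (Fin n)) :=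
  e.toHomeo.target ∩ e.toHomeo.symm ⁻¹' A

theorem isOpen_coordOpen (hA : IsOpen A) : IsOpen (e.coordOpen A) :=
  e.toHomeo.isOpen_inter_preimage_symm hA

theorem mem_coordOpen {p : ℝ × EuclideanSpace ℝ (Fin n)} :
    p ∈ e.coordOpen A ↔ p ∈ e.toHomeo.target ∧ (p.1, e.space p) ∈ A := by
  refine and_congr_right fun hp => ?_
  rw [mem_preimage, e.symm_eq hp]

theorem isOpen_setOf_graph_mem_coordOpen (hA : IsOpen A) :
    IsOpen {x : C1Space a b hab (EuclideanSpace ℝ (Fin n)) |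
      ∀ t : Icc a b, ((t : ℝ), x.1.1 t) ∈ e.coordOpen A} := by
  have hO : IsOpen {p : Icc a b × EuclideanSpace ℝ (Fin n) | ((p.1 : ℝ), p.2) ∈ e.coordOpen A} :=
    (e.isOpen_coordOpen hA).preimage (by fun_prop)
  exact (isOpen_setOf_graph_mem hO).preimage (continuous_fst.comp continuous_subtype_val)

variable [IsManifold (𝓡 n) ∞ M]

/-- Evaluated on a fixed vector, the frame is the bundle pairing of θᵢ with the image of a constant
vector field under the tangent map of `e.space`. Both are C¹. -/
theorem contDiffOn_frame (hθ : IsAnnihilatorFrame D A θ) :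
    ContDiffOn ℝ 1 (e.frame θ) (e.coordOpen A) := by
  have : IsManifold (𝓡 n) 1 M := IsManifold.of_le (n := ∞) (by simp)
  have hW := e.isOpen_coordOpen hθ.1
  refine contDiffOn_clm_apply.2 fun u => contDiffOn_pi.2 fun i p hp => ?_
  have hp' := (e.mem_coordOpen.1 hp)
  have hsec : ContMDiffWithinAt 𝓘(ℝ, ℝ × EuclideanSpace ℝ (Fin n))
      𝓘(ℝ, ℝ × EuclideanSpace ℝ (Fin n)).tangent 1
      (fun q => (⟨q, u⟩ : TangentBundle 𝓘(ℝ, ℝ × EuclideanSpace ℝ (Fin n)) _))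
      (e.coordOpen A) p :=
    contMDiffWithinAt_vectorSpace_iff_contDiffWithinAt.2 contDiffWithinAt_const
  have htan : ContMDiffOn 𝓘(ℝ, ℝ × EuclideanSpace ℝ (Fin n)).tangent (𝓡 n).tangent 1
      (tangentMapWithin 𝓘(ℝ, ℝ × EuclideanSpace ℝ (Fin n)) (𝓡 n) e.space (e.coordOpen A)) _ :=
    (e.contMDiffOn_space.mono inter_subset_left).contMDiffOn_tangentMapWithin (by
      rw [one_add_one_eq_two]
      exact WithTop.coe_le_coe.2 le_top) hW.uniqueMDiffOn
  have hv : ContMDiffWithinAt 𝓘(ℝ, ℝ × EuclideanSpace ℝ (Fin n)) (𝓡 n).tangent 1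
      (fun q => Bundle.TotalSpace.mk' (EuclideanSpace ℝ (Fin n))
        (E := fun m : M => TangentSpace (𝓡 n) m) (e.space q)
        (mfderiv 𝓘(ℝ, ℝ × EuclideanSpace ℝ (Fin n)) (𝓡 n) e.space q u)) (e.coordOpen A) p := by
    refine ((htan ⟨p, u⟩ hp).comp p hsec fun q hq => hq).congr_of_mem (fun q hq => ?_) hp
    change _ = Bundle.TotalSpace.mk' (EuclideanSpace ℝ (Fin n))
        (E := fun m : M => TangentSpace (𝓡 n) m) (e.space q)
        (mfderivWithin 𝓘(ℝ, ℝ × EuclideanSpace ℝ (Fin n)) (𝓡 n) e.space (e.coordOpen A) q u)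
    rw [mfderivWithin_of_isOpen hW hq]
  have hbase : ContMDiffWithinAt 𝓘(ℝ, ℝ × EuclideanSpace ℝ (Fin n)) (𝓘(ℝ, ℝ).prod (𝓡 n)) 1
      (fun q => (q.1, e.space q)) (e.coordOpen A) p :=
    (contDiff_fst.contMDiff.contMDiffAt.contMDiffWithinAt).prodMk
      (((e.contMDiffAt_space hp'.1).of_le (by simp)).contMDiffWithinAt)
  have hφ : ContMDiffWithinAt 𝓘(ℝ, ℝ × EuclideanSpace ℝ (Fin n))
      ((𝓡 n).prod 𝓘(ℝ, EuclideanSpace ℝ (Fin n) →L[ℝ] ℝ)) 1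
      (fun q => Bundle.TotalSpace.mk' (EuclideanSpace ℝ (Fin n) →L[ℝ] ℝ)
        (E := fun m : M => TangentSpace (𝓡 n) m →L[ℝ] Bundle.Trivial M ℝ m) (e.space q)
        (θ i (q.1, e.space q))) (e.coordOpen A) p :=
    (((hθ.2.1 i).of_le (by simp)) (p.1, e.space p) hp'.2).comp p hbase
      fun q hq => (e.mem_coordOpen.1 hq).2
  have h := ContMDiffWithinAt.clm_bundle_apply (𝕜 := ℝ) (E₁ := fun m : M => TangentSpace (𝓡 n) m)
    (E₂ := Bundle.Trivial M ℝ) (F₂ := ℝ) (b := fun q => e.space q)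
    (ϕ := fun q => θ i (q.1, e.space q)) hφ hv
  exact (Bundle.contMDiffWithinAt_totalSpace.1 h).2.contDiffWithinAt

theorem frame_surjective (hθ : IsAnnihilatorFrame D A θ) {p : ℝ × EuclideanSpace ℝ (Fin n)}
    (hp : p ∈ e.coordOpen A) (y : Fin d → ℝ) :
    ∃ w : EuclideanSpace ℝ (Fin n), e.frame θ p ((0 : ℝ), w) = y := by
  obtain ⟨hp, hpA⟩ := e.mem_coordOpen.1 hp
  have hli := (hθ.2.2 _ hpA).1
  obtain ⟨v, hv⟩ := exists_forall_apply_eq (V := EuclideanSpace ℝ (Fin n)) hli y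
  obtain ⟨w, hw⟩ := e.exists_mfderiv_space_eq hp v
  refine ⟨w, funext fun i => ?_⟩
  rw [frame_apply, hw]
  exact hv i

end TimeChart

theorem mem_iff_annihilatorFrame [IsManifold (𝓡 n) ∞ M] (hθ : IsAnnihilatorFrame D A θ)
    {p : ℝ × M} (hp : p ∈ A) (v : TangentSpace (𝓡 n) p.2) : v ∈ D p.2 ↔ ∀ i, θ i p v = 0 :=
  mem_iff_forall_apply_eq_zero (V := EuclideanSpace ℝ (Fin n)) (D := D p.2)
    (f := fun i => θ i p) (fun ℓ => by
      have h := (hθ.2.2 p hp).2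
      change ℓ ∈ Submodule.span ℝ (range fun i => θ i p) ↔ _
      rw [h]
      rfl) v

/-! ### The constraint map in coordinates -/

/-- The inclusion of `C¹([a,b], V)` into the continuous maps to `V × V`, given by a map and its
derivative. -/
def jet (a b : ℝ) (hab : a < b) (V : Type*) [NormedAddCommGroup V] [NormedSpace ℝ V] :
    C1Space a b hab V →L[ℝ] C(Icc a b, V × V) :=
  ((ContinuousLinearMap.inl ℝ V V).compLeftContinuous ℝ (Icc a b) ∘L
      ContinuousLinearMap.fst ℝ _ _ +
    (ContinuousLinearMap.inr ℝ V V).compLeftContinuous ℝ (Icc a b) ∘L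
      ContinuousLinearMap.snd ℝ _ _) ∘L (C1Space a b hab V).subtypeL

theorem jet_apply {a b : ℝ} {hab : a < b} {V : Type*} [NormedAddCommGroup V] [NormedSpace ℝ V]
    (x : C1Space a b hab V) (t : Icc a b) : jet a b hab V x t = (x.1.1 t, x.1.2 t) := by
  simp [jet]

namespace TimeChart

variable [IsManifold (𝓡 n) ∞ M]

/-- Curves with graph in `A` never meet the default value of `constraintMap`, so the formula for Θ
is available in coordinates. -/
theorem constraintMap_curve_apply (hθ : IsAnnihilatorFrame D A θ)
    {x : C1Space a b hab (EuclideanSpace ℝ (Fin n))}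
    (hx : ∀ t : Icc a b, ((t : ℝ), x.1.1 t) ∈ e.coordOpen A) (t : Icc a b) :
    (∀ i, constraintMap a b θ (e.curve x) t i =
      θ i ((t : ℝ), e.curve x t) (velocity n a b (e.curve x) t)) ∧
    constraintMap a b θ (e.curve x) t = e.frame θ ((t : ℝ), x.1.1 t) ((1 : ℝ), x.1.2 t) := by
  have hx' : ∀ t : Icc a b, ((t : ℝ), x.1.1 t) ∈ e.toHomeo.target :=
    fun t => (e.mem_coordOpen.1 (hx t)).1
  have hc := continuous_frameVelocity hab hθ (contMDiffOn_curve hx') (fun s hs => by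
    have h := (e.mem_coordOpen.1 (hx ⟨s, hs⟩)).2
    rwa [← e.curve_coe x ⟨s, hs⟩] at h)
  have h1 : ∀ i, constraintMap a b θ (e.curve x) t i =
      θ i ((t : ℝ), e.curve x t) (velocity n a b (e.curve x) t) := fun i => by
    rw [constraintMap, dif_pos hc]
    rfl
  refine ⟨h1, funext fun i => ?_⟩
  rw [h1, velocity_curve hx']
  change e.frame θ ((t : ℝ), IccExtend hab.le x.1.1 t) ((1 : ℝ), x.1.2 t) i = _
  rw [IccExtend_val]

/-- Near `x`, Θ is the superposition operator of H(t, u, w) = frame(t, u)(1, w) applied to the 1-jet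
of the curve. Thus β and B are the partial derivatives of H in w and u. Since H is affine in w, β is
the frame on vectors (0, w), which is onto. -/
theorem constraintMap_differentiable (hθ : IsAnnihilatorFrame D A θ)
    {x : C1Space a b hab (EuclideanSpace ℝ (Fin n))}
    (hx : ∀ t : Icc a b, ((t : ℝ), x.1.1 t) ∈ e.coordOpen A) :
    ∃ (L : C1Space a b hab (EuclideanSpace ℝ (Fin n)) →L[ℝ] C(Icc a b, Fin d → ℝ))
      (β B : C(Icc a b, EuclideanSpace ℝ (Fin n) →L[ℝ] (Fin d → ℝ))),
      (∀ y t, L y t = β t (y.1.2 t) + B t (y.1.1 t)) ∧ (∀ t, Function.Surjective (β t)) ∧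
      HasFDerivAt (fun y => constraintMap a b θ (e.curve y)) L x ∧
      ContDiffAt ℝ 1 (fun y : C1Space a b hab (EuclideanSpace ℝ (Fin n)) =>
        constraintMap a b θ (e.curve y)) x := by
  let E := EuclideanSpace ℝ (Fin n)
  let W := e.coordOpen A
  have hW : IsOpen W := e.isOpen_coordOpen hθ.1
  let H : ℝ × E × E → (Fin d → ℝ) := fun p => e.frame θ (p.1, p.2.1) ((1 : ℝ), p.2.2)
  let O' : Set (ℝ × E × E) := {p | (p.1, p.2.1) ∈ W}
  have hO' : IsOpen O' := hW.preimage (by fun_prop)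
  have hH : ContDiffOn ℝ 1 H O' := by
    have h1 : ContDiffOn ℝ 1 (fun p : ℝ × E × E => e.frame θ (p.1, p.2.1)) O' :=
      (e.contDiffOn_frame hθ).comp (by fun_prop : ContDiff ℝ 1 fun p : ℝ × E × E =>
        (p.1, p.2.1)).contDiffOn fun p hp => hp
    exact h1.clm_apply (by fun_prop : ContDiff ℝ 1 fun p : ℝ × E × E =>
        ((1 : ℝ), p.2.2)).contDiffOn
  -- Time is a mere parameter here: only the derivative in position and velocity enters.
  let h : Icc a b × E × E → (Fin d → ℝ) := fun p => H (p.1, p.2)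
  let h' : Icc a b × E × E → E × E →L[ℝ] (Fin d → ℝ) := fun p =>
    fderiv ℝ H (p.1, p.2) ∘L ContinuousLinearMap.inr ℝ ℝ (E × E)
  let O : Set (Icc a b × E × E) := {p | ((p.1 : ℝ), p.2) ∈ O'}
  have hincl : Continuous fun p : Icc a b × E × E => ((p.1 : ℝ), p.2) := by fun_prop
  have hO : IsOpen O := hO'.preimage hincl
  have hh : ContinuousOn h O := hH.continuousOn.comp hincl.continuousOn fun p hp => hp
  have hh' : ContinuousOn h' O :=
    ((hH.continuousOn_fderiv_of_isOpen hO' le_rfl).comp hincl.continuousOn fun p hp => hp).clm_comp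
      continuousOn_const
  have hd : ∀ p ∈ O, HasFDerivAt (fun z => h (p.1, z)) (h' p) p.2 := fun p hp => by
    have h1 : HasFDerivAt H (fderiv ℝ H (p.1, p.2)) ((p.1 : ℝ), p.2) :=
      ((hH.contDiffAt (hO'.mem_nhds hp)).differentiableAt one_ne_zero).hasFDerivAt
    exact h1.comp p.2 (hasFDerivAt_prodMk_right (p.1 : ℝ) p.2)
  let J := jet a b hab E
  have hJ : ∀ t, (t, J x t) ∈ O := fun t => by
    change ((t : ℝ), (J x t).1) ∈ W
    rw [jet_apply]
    exact hx t
  have hev : (fun y : C1Space a b hab E => constraintMap a b θ (e.curve y)) =ᶠ[𝓝 x]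
      fun y => superposition h (J y) := by
    filter_upwards [(e.isOpen_setOf_graph_mem_coordOpen hθ.1).mem_nhds hx] with y hy
    ext1 t
    rw [(e.constraintMap_curve_apply hθ hy t).2, superposition_apply hh (fun t => ?_)]
    · change _ = e.frame θ ((t : ℝ), (J y t).1) ((1 : ℝ), (J y t).2)
      rw [jet_apply]
    · change ((t : ℝ), (J y t).1) ∈ W
      rw [jet_apply]
      exact hy t
  have hJ' : Continuous fun t => h' (t, J x t) :=
    hh'.comp_continuous (f := fun t => (t, J x t)) (by fun_prop) hJ
  have hcomp : HasFDerivAt (fun y => superposition h (J y))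
      (applyCLM _ _ (superposition h' (J x)) ∘L J) x :=
    (hasFDerivAt_superposition hO hh hh' hd hJ).comp x J.hasFDerivAt
  have hJc : ContDiff ℝ 1 J := by fun_prop
  refine ⟨applyCLM _ _ (superposition h' (J x)) ∘L J,
    ⟨fun t => h' (t, J x t) ∘L ContinuousLinearMap.inr ℝ E E, hJ'.clm_comp continuous_const⟩,
    ⟨fun t => h' (t, J x t) ∘L ContinuousLinearMap.inl ℝ E E, hJ'.clm_comp continuous_const⟩,
    fun y t => ?_, fun t y => ?_, hcomp.congr_of_eventuallyEq hev,
    ((contDiffAt_superposition hO hh hh' hd hJ).comp x hJc.contDiffAt).congr_of_eventuallyEq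
      hev⟩
  · change superposition h' (J x) t (J y t) =
      h' (t, J x t) ((0 : E), y.1.2 t) + h' (t, J x t) (y.1.1 t, (0 : E))
    have h1 : J y t = (y.1.1 t, y.1.2 t) := jet_apply y t
    rw [superposition_apply hh' hJ, ← map_add, h1]
    simp
  · obtain ⟨w, hw⟩ := e.frame_surjective hθ (hx t) y
    refine ⟨w, ?_⟩
    -- The derivative in the velocity is computed twice, abstractly and from affineness of H;
    -- uniqueness identifies β(t) with the frame on (0, w).
    have h1 : HasFDerivAt (fun w' : E => h (t, (x.1.1 t, w')))
        (h' (t, J x t) ∘L ContinuousLinearMap.inr ℝ E E) (x.1.2 t) := by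
      have h2 := hd (t, J x t) (hJ t)
      simp only [J, jet_apply] at h2 ⊢
      exact HasFDerivAt.comp (x.1.2 t) h2 (hasFDerivAt_prodMk_right (x.1.1 t) (x.1.2 t))
    have h2 : HasFDerivAt (fun w' : E => h (t, (x.1.1 t, w')))
        (e.frame θ ((t : ℝ), x.1.1 t) ∘L ContinuousLinearMap.inr ℝ ℝ E) (x.1.2 t) :=
      (e.frame θ ((t : ℝ), x.1.1 t)).hasFDerivAt.comp (x.1.2 t)
        (hasFDerivAt_prodMk_right (1 : ℝ) (x.1.2 t))
    change (h' (t, J x t) ∘L ContinuousLinearMap.inr ℝ E E) w = y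
    rw [h1.unique h2]
    exact hw

end TimeChart

end Constraint

/-! ### End points of curves -/

section EndPoints

variable {n : ℕ} {M : Type*} [TopologicalSpace M] [ChartedSpace (EuclideanSpace ℝ (Fin n)) M]
  {a b : ℝ} {hab : a < b}

/-- The projection of `ℝⁿ` to the coordinates that vanish on the slice `ℝʳ × {0}`. -/
def sliceProj (n r : ℕ) : EuclideanSpace ℝ (Fin n) →L[ℝ] ({i : Fin n // r ≤ (i : ℕ)} → ℝ) :=
  ContinuousLinearMap.pi fun i => EuclideanSpace.proj i.1

theorem sliceProj_eq_zero {r : ℕ} {x : EuclideanSpace ℝ (Fin n)} :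
    sliceProj n r x = 0 ↔ x ∈ slice n r :=
  ⟨fun h i hi => congr_fun h ⟨i, hi⟩, fun h => funext fun i => h i.1 i.2⟩

theorem sliceProj_surjective (n r : ℕ) : Function.Surjective (sliceProj n r) := by
  intro y
  refine ⟨WithLp.toLp 2 fun i => if h : r ≤ (i : ℕ) then y ⟨i, h⟩ else 0, funext fun i => ?_⟩
  change (if h : r ≤ (i.1 : ℕ) then y ⟨i.1, h⟩ else 0) = y i
  rw [dif_pos i.2]

/-- The evaluation of `C¹` maps at a point of `[a,b]`. -/
def evalAt (hab : a < b) (V : Type*) [NormedAddCommGroup V] [NormedSpace ℝ V] (t : Icc a b) :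
    C1Space a b hab V →L[ℝ] V :=
  ContinuousMap.evalCLM ℝ t ∘L ContinuousLinearMap.fst ℝ _ _ ∘L (C1Space a b hab V).subtypeL

/-- An affine path suffices; this is the independence of the two end-point conditions. -/
theorem exists_evalAt_eq {V : Type*} [NormedAddCommGroup V] [NormedSpace ℝ V] (hab : a < b)
    (v w : V) : ∃ x, evalAt hab V (leftPt hab) x = v ∧ evalAt hab V (rightPt hab) x = w := by
  have hba : b - a ≠ 0 := (sub_pos.2 hab).ne'
  refine ⟨⟨(⟨fun t => v + (((t : ℝ) - a) / (b - a)) • (w - v), by fun_prop⟩,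
    ContinuousMap.const _ ((1 / (b - a)) • (w - v))), fun t => ?_⟩, ?_, ?_⟩
  · have h1 : HasDerivWithinAt (fun s : ℝ => v + ((s - a) / (b - a)) • (w - v))
        ((1 / (b - a)) • (w - v)) (Icc a b) t :=
      (((((hasDerivAt_id (t : ℝ)).sub_const a).div_const (b - a)).smul_const
        (w - v)).const_add v).hasDerivWithinAt
    exact h1.congr (fun s hs => IccExtend_of_mem _ _ hs) (IccExtend_of_mem _ _ t.2)
  · change v + ((a - a) / (b - a)) • (w - v) = v
    simp
  · change v + ((b - a) / (b - a)) • (w - v) = w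
    simp [div_self hba]

variable {φ : OpenPartialHomeomorph M (EuclideanSpace ℝ (Fin n))}

theorem mdifferentiable_of_mem_maximalAtlas
    (hφ : φ ∈ IsManifold.maximalAtlas (𝓡 n) ∞ M) : φ.MDifferentiable (𝓡 n) (𝓡 n) :=
  ⟨(contMDiffOn_of_mem_maximalAtlas hφ).mdifferentiableOn (by simp),
    (contMDiffOn_symm_of_mem_maximalAtlas hφ).mdifferentiableOn (by simp)⟩

namespace TimeChart

variable (e : TimeChart n M)

theorem contMDiffAt_curve_apply {x : C1Space a b hab (EuclideanSpace ℝ (Fin n))} (t : Icc a b)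
    (hx : ((t : ℝ), x.1.1 t) ∈ e.toHomeo.target) :
    ContMDiffAt 𝓘(ℝ, C1Space a b hab (EuclideanSpace ℝ (Fin n))) (𝓡 n) 1
      (fun y => e.curve y t) x := by
  have h1 : ContDiff ℝ 1 (evalAt hab (EuclideanSpace ℝ (Fin n)) t) := by fun_prop
  have h2 : ContDiff ℝ 1 fun y => ((t : ℝ), evalAt hab (EuclideanSpace ℝ (Fin n)) t y) :=
    contDiff_const.prodMk h1
  have h3 : ContMDiffAt 𝓘(ℝ, ℝ × EuclideanSpace ℝ (Fin n)) (𝓡 n) 1 e.space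
      ((t : ℝ), evalAt hab (EuclideanSpace ℝ (Fin n)) t x) :=
    (e.contMDiffAt_space hx).of_le (by simp)
  have h4 := ContMDiffAt.comp x h3 h2.contDiffAt.contMDiffAt
  refine h4.congr_of_eventuallyEq (Eventually.of_forall fun y => ?_)
  exact e.curve_coe y t

/-- The map factors through evaluation at `t`. The remaining factor has surjective differential,
because φ is a diffeomorphism and `e.space` is already onto in the space directions. -/
theorem exists_hasFDerivAt_chart {Y : Type*} [NormedAddCommGroup Y] [NormedSpace ℝ Y]
    {p : EuclideanSpace ℝ (Fin n) →L[ℝ] Y} (hp : Function.Surjective p)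
    (hφ : φ ∈ IsManifold.maximalAtlas (𝓡 n) ∞ M)
    {x : C1Space a b hab (EuclideanSpace ℝ (Fin n))} (t : Icc a b)
    (hx : ((t : ℝ), x.1.1 t) ∈ e.toHomeo.target) (hxφ : e.curve x t ∈ φ.source) :
    ∃ q : EuclideanSpace ℝ (Fin n) →L[ℝ] Y, Function.Surjective q ∧
      HasFDerivAt (fun y => p (φ (e.curve y t)))
        (q ∘L evalAt hab (EuclideanSpace ℝ (Fin n)) t) x ∧
      ContDiffAt ℝ 1 (fun y => p (φ (e.curve y t))) x := by
  let E := EuclideanSpace ℝ (Fin n)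
  rw [e.curve_coe] at hxφ
  have h1 : ContMDiffAt (𝓡 n) (𝓡 n) ∞ φ (e.space ((t : ℝ), x.1.1 t)) :=
    contMDiffAt_of_mem_maximalAtlas hφ hxφ
  have h2 := h1.comp ((t : ℝ), x.1.1 t) (e.contMDiffAt_space hx)
  have h3 : ContDiffAt ℝ 1 (fun w : E => φ (e.space ((t : ℝ), w))) (x.1.1 t) :=
    (h2.contDiffAt.of_le (by simp)).comp (x.1.1 t) (contDiffAt_const.prodMk contDiffAt_id)
  let κ := fderiv ℝ (fun w : E => φ (e.space ((t : ℝ), w))) (x.1.1 t)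
  have hκ : HasFDerivAt (fun w : E => φ (e.space ((t : ℝ), w))) κ (x.1.1 t) :=
    (h3.differentiableAt one_ne_zero).hasFDerivAt
  have hκs : Function.Surjective κ := by
    intro z
    obtain ⟨v, hv⟩ := (mdifferentiable_of_mem_maximalAtlas hφ).mfderiv_surjective hxφ z
    obtain ⟨w, hw⟩ := e.exists_mfderiv_space_eq hx v
    refine ⟨w, ?_⟩
    have h4 := ((h1.mdifferentiableAt (by simp)).hasMFDerivAt.comp ((t : ℝ), x.1.1 t)
      (e.mdifferentiableAt_space hx).hasMFDerivAt).hasFDerivAt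
    have h5 := h4.comp (x.1.1 t) (hasFDerivAt_prodMk_right (t : ℝ) (x.1.1 t))
    rw [hκ.unique h5]
    change mfderiv (𝓡 n) (𝓡 n) φ (e.space ((t : ℝ), x.1.1 t))
      (mfderiv 𝓘(ℝ, ℝ × E) (𝓡 n) e.space ((t : ℝ), x.1.1 t) ((0 : ℝ), w)) = z
    rw [hw, hv]
  have hfun : (fun y : C1Space a b hab E => p (φ (e.curve y t))) =
      fun y => p (φ (e.space ((t : ℝ), evalAt hab E t y))) :=
    funext fun y => by rw [e.curve_coe]; rfl
  rw [hfun]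
  have hev : ContDiff ℝ 1 (evalAt hab E t) := by fun_prop
  refine ⟨p ∘L κ, hp.comp hκs, ?_, ?_⟩
  · have h4 : HasFDerivAt (evalAt hab E t) (evalAt hab E t) x :=
      ContinuousLinearMap.hasFDerivAt (𝕜 := ℝ) (E := C1Space a b hab E) (F := E) (evalAt hab E t)
    exact HasFDerivAt.comp (g := fun w : E => p (φ (e.space ((t : ℝ), w))))
      (f := evalAt hab E t) x
      (p.hasFDerivAt.comp (x.1.1 t) hκ) h4
  · exact ContDiffAt.comp (g := fun w : E => p (φ (e.space ((t : ℝ), w)))) x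
      (p.contDiff.contDiffAt.comp (x.1.1 t) h3) hev.contDiffAt

end TimeChart

/-! ### Transversality to a submanifold -/

variable {F : Type*} [NormedAddCommGroup F] [NormedSpace ℝ F] {f : F → M} {y : F} {s : ℕ}
  {Q : Set M}

theorem fderiv_sliceProj_chart (hf : ContMDiffAt 𝓘(ℝ, F) (𝓡 n) 1 f y)
    (hφ : IsSliceChart s Q (f y) φ) (v : F) :
    fderiv ℝ (fun z => sliceProj n s (φ (f z))) y v =
      sliceProj n s (mfderiv (𝓡 n) (𝓡 n) φ (f y) (mfderiv 𝓘(ℝ, F) (𝓡 n) f y v)) := by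
  have h1 : ContMDiffAt (𝓡 n) (𝓡 n) ∞ φ (f y) := contMDiffAt_of_mem_maximalAtlas hφ.1 hφ.2.1
  have h2 := ((h1.mdifferentiableAt (by simp)).hasMFDerivAt.comp y
    (hf.mdifferentiableAt one_ne_zero).hasMFDerivAt).hasFDerivAt
  have h3 := (sliceProj n s).hasFDerivAt.comp y h2
  have h4 : fderiv ℝ (fun z => sliceProj n s (φ (f z))) y = _ := h3.fderiv
  rw [h4]
  rfl

/-- The transverse coordinates of a slice chart have differential onto with kernel the tangent space
of `Q`, so spanning modulo that tangent space becomes surjectivity. -/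
theorem TransverseAt.exists_surjective_fderiv (h : TransverseAt (n := n) f y s Q) :
    ∃ φ, IsSliceChart s Q (f y) φ ∧
      Function.Surjective (fderiv ℝ (fun z => sliceProj n s (φ (f z))) y) := by
  obtain ⟨hf, T, K, ⟨φ, hφ, hT⟩, hspan, -, -⟩ := h
  refine ⟨φ, hφ, fun z => ?_⟩
  obtain ⟨z', rfl⟩ := sliceProj_surjective n s z
  obtain ⟨w, rfl⟩ := (mdifferentiable_of_mem_maximalAtlas hφ.1).mfderiv_surjective hφ.2.1 z'
  obtain ⟨v, u, hu, rfl⟩ := hspan w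
  refine ⟨v, ?_⟩
  rw [fderiv_sliceProj_chart hf hφ, map_add]
  have h0 := sliceProj_eq_zero.2 ((hT u).1 hu)
  exact (add_zero _).symm.trans ((congrArg _ h0.symm).trans ((sliceProj n s).map_add _ _).symm)

/-- The preimage of the tangent space is the kernel of an operator of finite rank, so its complement
is automatic. -/
theorem transverseAt_of_surjective_fderiv (hf : ContMDiffAt 𝓘(ℝ, F) (𝓡 n) 1 f y)
    (hφ : IsSliceChart s Q (f y) φ)
    (hs : Function.Surjective (fderiv ℝ (fun z => sliceProj n s (φ (f z))) y)) :
    TransverseAt (n := n) f y s Q := by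
  let T : Submodule ℝ (TangentSpace (𝓡 n) (f y)) :=
    (slice n s).comap (mfderiv (𝓡 n) (𝓡 n) φ (f y)).toLinearMap
  refine ⟨hf, T, (fderiv ℝ (fun z => sliceProj n s (φ (f z))) y).ker,
    ⟨φ, hφ, fun v => Iff.rfl⟩, fun w => ?_, fun v => ?_,
    ContinuousLinearMap.ker_closedComplemented_of_finiteDimensional_range _⟩
  · obtain ⟨v, hv⟩ := hs (sliceProj n s (mfderiv (𝓡 n) (𝓡 n) φ (f y) w))
    rw [fderiv_sliceProj_chart hf hφ] at hv
    refine ⟨v, w - mfderiv 𝓘(ℝ, F) (𝓡 n) f y v, ?_, add_sub_cancel _ _⟩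
    change mfderiv (𝓡 n) (𝓡 n) φ (f y) (w - mfderiv 𝓘(ℝ, F) (𝓡 n) f y v) ∈ slice n s
    refine sliceProj_eq_zero.1 ?_
    rw [map_sub]
    exact ((sliceProj n s).map_sub _ _).trans (sub_eq_zero.2 hv.symm)
  · rw [LinearMap.mem_ker]
    change fderiv ℝ (fun z => sliceProj n s (φ (f z))) y v = 0 ↔
      mfderiv (𝓡 n) (𝓡 n) φ (f y) (mfderiv 𝓘(ℝ, F) (𝓡 n) f y v) ∈ slice n s
    rw [fderiv_sliceProj_chart hf hφ]
    exact sliceProj_eq_zero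

end EndPoints

/-! ### The two sets of curves in coordinates -/

section Sets

variable {n d r s : ℕ} {M : Type*} [TopologicalSpace M]
  [ChartedSpace (EuclideanSpace ℝ (Fin n)) M]
  {D : ∀ m : M, Submodule ℝ (TangentSpace (𝓡 n) m)} {P Q : Set M} {A : Set (ℝ × M)}
  {a b : ℝ} {hab : a < b} {γ γ' : ℝ → M}

/-- Curves are functions on ℝ, and the coordinate curve agrees with `γ` only on [a,b]; horizontality
has to be carried over. -/
theorem mem_horizontalCurves_congr (hγ : γ ∈ horizontalCurves a b P D) (hab : a < b)
    (h : ∀ t ∈ Icc a b, γ' t = γ t) : γ' ∈ horizontalCurves a b P D := by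
  have ha := h a (left_mem_Icc.2 hab.le)
  refine ⟨hγ.1.congr h, ha ▸ hγ.2.1, fun t ht => ?_⟩
  have hv : (velocity n a b γ' t : EuclideanSpace ℝ (Fin n)) = velocity n a b γ t := by
    have h1 := mfderivWithin_congr (I := 𝓘(ℝ, ℝ)) (I' := 𝓡 n) h (h t ht)
    exact congrArg (fun L : ℝ →L[ℝ] EuclideanSpace ℝ (Fin n) => L (1 : ℝ)) h1
  -- The velocities live over base points that are equal only propositionally. Viewing them in the
  -- model space and generalizing the points lets the equality be eliminated.
  have key : ∀ (m m' : M) (v : EuclideanSpace ℝ (Fin n)), m' = m →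
      (show TangentSpace (𝓡 n) m from v) ∈ D m → (show TangentSpace (𝓡 n) m' from v) ∈ D m' := by
    rintro m _ v rfl hv
    exact hv
  have h2 := key (γ t) (γ' t) (velocity n a b γ t) (h t ht) (hγ.2.2 t ht)
  rw [← hv] at h2
  exact h2

variable {e : TimeChart n M} {x : C1Space a b hab (EuclideanSpace ℝ (Fin n))}

theorem graph_mem_target (hγ : ∀ t : Icc a b, ((t : ℝ), γ t) ∈ e.toHomeo.source)
    (hx : ∀ t : Icc a b, e.toHomeo ((t : ℝ), γ t) = ((t : ℝ), x.1.1 t)) (t : Icc a b) :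
    ((t : ℝ), x.1.1 t) ∈ e.toHomeo.target := by
  rw [← hx]
  exact e.toHomeo.map_source (hγ t)

theorem curve_eq_of_graph (hγ : ∀ t : Icc a b, ((t : ℝ), γ t) ∈ e.toHomeo.source)
    (hx : ∀ t : Icc a b, e.toHomeo ((t : ℝ), γ t) = ((t : ℝ), x.1.1 t)) (t : ℝ)
    (ht : t ∈ Icc a b) : e.curve x t = γ t := by
  rw [e.curve_coe x ⟨t, ht⟩, ← hx ⟨t, ht⟩, TimeChart.space, e.toHomeo.left_inv (hγ ⟨t, ht⟩)]

theorem mem_iff_sliceProj_eq_zero {m : M} {φ : OpenPartialHomeomorph M (EuclideanSpace ℝ (Fin n))}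
    (hφ : IsSliceChart r P m φ) {z : M} (hz : z ∈ φ.source) :
    z ∈ P ↔ sliceProj n r (φ z) = 0 :=
  (hφ.2.2 z hz).trans sliceProj_eq_zero.symm

theorem eventually_curve_mem_source (t : Icc a b)
    (hx : ∀ t : Icc a b, ((t : ℝ), x.1.1 t) ∈ e.toHomeo.target)
    {φ : OpenPartialHomeomorph M (EuclideanSpace ℝ (Fin n))}
    (hφ : IsSliceChart r P (e.curve x t) φ) : ∀ᶠ y in 𝓝 x, e.curve y t ∈ φ.source :=
  (e.contMDiffAt_curve_apply t (hx t)).continuousAt.eventually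
    (φ.open_source.eventually_mem hφ.2.1)

variable {θ : Fin d → ∀ p : ℝ × M, TangentSpace (𝓡 n) p.2 →L[ℝ] ℝ}
  {φ φ' : OpenPartialHomeomorph M (EuclideanSpace ℝ (Fin n))}

/-- Having the graph in `A` is an open condition, so near `x` only the two end-point equations
remain. -/
theorem eventually_mem_coordSet_curvesWithGraphIn (hA : IsOpen A)
    (hx : ∀ t : Icc a b, ((t : ℝ), x.1.1 t) ∈ e.coordOpen A)
    (hφ : IsSliceChart r P (e.curve x a) φ) (hφ' : IsSliceChart s Q (e.curve x b) φ') :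
    ∀ᶠ y in 𝓝 x, y ∈ e.coordSet hab (curvesWithGraphIn n a b P Q A) ↔
      sliceProj n r (φ (e.curve y a)) = 0 ∧ sliceProj n s (φ' (e.curve y b)) = 0 := by
  have hx' := fun t => (e.mem_coordOpen.1 (hx t)).1
  filter_upwards [(e.isOpen_setOf_graph_mem_coordOpen hA).mem_nhds hx,
    eventually_curve_mem_source (leftPt hab) hx' hφ,
    eventually_curve_mem_source (rightPt hab) hx' hφ'] with y hy hya hyb
  have hy' := fun t => (e.mem_coordOpen.1 (hy t)).1
  rw [← mem_iff_sliceProj_eq_zero hφ hya, ← mem_iff_sliceProj_eq_zero hφ' hyb]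
  refine ⟨fun h => ⟨h.2.2.1, h.2.2.2.1⟩, fun h => ⟨hy', TimeChart.contMDiffOn_curve hy', h.1, h.2,
    fun t ht => ?_⟩⟩
  rw [e.curve_coe y ⟨t, ht⟩]
  exact (e.mem_coordOpen.1 (hy ⟨t, ht⟩)).2

variable [IsManifold (𝓡 n) ∞ M]

/-- Since `D` is the common kernel of the θᵢ, horizontality is the equation Θ = 0 as long as the
graph stays in `A`. -/
theorem eventually_mem_coordSet_horizontalCurves (hθ : IsAnnihilatorFrame D A θ)
    (hx : ∀ t : Icc a b, ((t : ℝ), x.1.1 t) ∈ e.coordOpen A)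
    (hφ : IsSliceChart r P (e.curve x a) φ) :
    ∀ᶠ y in 𝓝 x, y ∈ e.coordSet hab (horizontalCurves a b P D) ↔
      sliceProj n r (φ (e.curve y a)) = 0 ∧ constraintMap a b θ (e.curve y) = 0 := by
  have hx' := fun t => (e.mem_coordOpen.1 (hx t)).1
  filter_upwards [(e.isOpen_setOf_graph_mem_coordOpen hθ.1).mem_nhds hx,
    eventually_curve_mem_source (leftPt hab) hx' hφ] with y hy hya
  have hy' := fun t => (e.mem_coordOpen.1 (hy t)).1
  rw [← mem_iff_sliceProj_eq_zero hφ hya]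
  have hD : ∀ t : Icc a b, velocity n a b (e.curve y) t ∈ D (e.curve y t) ↔
      constraintMap a b θ (e.curve y) t = 0 := fun t => by
    have hA : ((t : ℝ), e.curve y t) ∈ A := by
      rw [e.curve_coe y t]
      exact (e.mem_coordOpen.1 (hy t)).2
    refine (mem_iff_annihilatorFrame hθ hA _).trans (Iff.trans ?_ funext_iff.symm)
    exact forall_congr' fun i => by
      rw [(e.constraintMap_curve_apply hθ hy t).1 i]
      rfl
  refine ⟨fun h => ⟨h.2.2.1, ContinuousMap.ext fun t => (hD t).1 (h.2.2.2 t t.2)⟩,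
    fun h => ⟨hy', TimeChart.contMDiffOn_curve hy', h.1, fun t ht => ?_⟩⟩
  exact (hD ⟨t, ht⟩).2 (by rw [h.2]; rfl)

/-- The differentials, at a curve, of the maps that define the two sets of curves. -/
theorem exists_constraint_differentials (hθ : IsAnnihilatorFrame D A θ)
    (hx : ∀ t : Icc a b, ((t : ℝ), x.1.1 t) ∈ e.coordOpen A)
    (hφ : IsSliceChart r P (e.curve x a) φ) (hφ' : IsSliceChart s Q (e.curve x b) φ') :
    ∃ (L₁ : C1Space a b hab (EuclideanSpace ℝ (Fin n)) →L[ℝ] ({i : Fin n // r ≤ (i : ℕ)} → ℝ))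
      (L₂ : C1Space a b hab (EuclideanSpace ℝ (Fin n)) →L[ℝ] ({i : Fin n // s ≤ (i : ℕ)} → ℝ))
      (L₃ : C1Space a b hab (EuclideanSpace ℝ (Fin n)) →L[ℝ] C(Icc a b, Fin d → ℝ))
      (R : ({i : Fin n // r ≤ (i : ℕ)} → ℝ) × C(Icc a b, Fin d → ℝ) →L[ℝ]
        C1Space a b hab (EuclideanSpace ℝ (Fin n))),
      (HasFDerivAt (fun y => sliceProj n r (φ (e.curve y a))) L₁ x ∧
        ContDiffAt ℝ 1 (fun y : C1Space a b hab (EuclideanSpace ℝ (Fin n)) =>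
          sliceProj n r (φ (e.curve y a))) x) ∧
      (HasFDerivAt (fun y => sliceProj n s (φ' (e.curve y b))) L₂ x ∧
        ContDiffAt ℝ 1 (fun y : C1Space a b hab (EuclideanSpace ℝ (Fin n)) =>
          sliceProj n s (φ' (e.curve y b))) x) ∧
      (HasFDerivAt (fun y => constraintMap a b θ (e.curve y)) L₃ x ∧
        ContDiffAt ℝ 1 (fun y : C1Space a b hab (EuclideanSpace ℝ (Fin n)) =>
          constraintMap a b θ (e.curve y)) x) ∧
      (∀ p, L₁ (R p) = p.1) ∧ (∀ p, L₃ (R p) = p.2) ∧ Function.Surjective (L₁.prod L₂) := by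
  have hx' := fun t => (e.mem_coordOpen.1 (hx t)).1
  obtain ⟨q₁, hq₁, hd₁, hc₁⟩ := e.exists_hasFDerivAt_chart (sliceProj_surjective n r) hφ.1
    (leftPt hab) (hx' _) hφ.2.1
  obtain ⟨q₂, hq₂, hd₂, hc₂⟩ := e.exists_hasFDerivAt_chart (sliceProj_surjective n s) hφ'.1
    (rightPt hab) (hx' _) hφ'.2.1
  obtain ⟨L₃, β, B, hL₃, hβ, hd₃, hc₃⟩ := e.constraintMap_differentiable hθ hx
  obtain ⟨ρ, hρ⟩ := exists_continuous_rightInverse β hβ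
  obtain ⟨R, hR⟩ := exists_solution_operator hab β B ρ hρ
  obtain ⟨q₁', hq₁'⟩ := q₁.exists_rightInverse_of_surjective (LinearMap.range_eq_top.2 hq₁)
  -- The solution operator prescribes the initial value in ℝⁿ; a right inverse of `q₁` converts
  -- prescribed transverse coordinates into such a value.
  refine ⟨_, _, L₃, R ∘L q₁'.prodMap (ContinuousLinearMap.id ℝ _), ⟨hd₁, hc₁⟩, ⟨hd₂, hc₂⟩,
    ⟨hd₃, hc₃⟩, fun p => ?_, fun p => ?_, fun p => ?_⟩
  · change q₁ ((R (q₁' p.1, p.2)).1.1 (leftPt hab)) = p.1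
    rw [(hR _).1]
    exact congr($hq₁' p.1)
  · ext1 t
    rw [hL₃]
    exact (hR (q₁' p.1, p.2)).2 t
  · obtain ⟨v, hv⟩ := hq₁ p.1
    obtain ⟨w, hw⟩ := hq₂ p.2
    obtain ⟨y, hyv, hyw⟩ := exists_evalAt_eq hab v w
    refine ⟨y, Prod.ext ?_ ?_⟩
    · change q₁ (evalAt hab _ (leftPt hab) y) = p.1
      rw [hyv, hv]
    · change q₂ (evalAt hab _ (rightPt hab) y) = p.2
      rw [hyw, hw]

/-! ### The two implications -/

theorem isSubmersionAtCurve_of_isRegularCurve (hP : IsEmbeddedSubmanifold n r P)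
    (hab : a < b) (hθ : IsAnnihilatorFrame D A θ)
    (hγ : γ ∈ horizontalCurves a b P D) (hγQ : γ b ∈ Q) (hγA : ∀ t ∈ Icc a b, (t, γ t) ∈ A)
    (hreg : IsRegularCurve hab P s Q D γ) :
    IsSubmersionAtCurve (n := n) hab P Q A (constraintMap a b θ) γ := by
  have ha : a ∈ Icc a b := left_mem_Icc.2 hab.le
  have hb : b ∈ Icc a b := right_mem_Icc.2 hab.le
  obtain ⟨c, hc⟩ := hreg
  have hcurve := curve_eq_of_graph c.graph_mem c.x_eq
  have htar := graph_mem_target c.graph_mem c.x_eq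
  have hx : ∀ t : Icc a b, ((t : ℝ), c.x.1.1 t) ∈ c.e.coordOpen A := fun t =>
    c.e.mem_coordOpen.2 ⟨htar t, by
      rw [← c.e.curve_coe, hcurve t t.2]
      exact hγA t t.2⟩
  -- The slice chart of `Q` must be the one supplied by transversality, since surjectivity is
  -- expressed in it.
  obtain ⟨φ', hφ', hs⟩ := hc.exists_surjective_fderiv
  have hbase : c.param c.base b = c.e.curve c.x b :=
    congrArg (fun y => c.e.curve y b) c.toStraighteningChart.param_base
  rw [hbase] at hφ'
  obtain ⟨φ, hφ⟩ := hP.2 (γ a) hγ.2.1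
  rw [← hcurve a ha] at hφ
  obtain ⟨L₁, L₂, L₃, R, h₁, h₂, h₃, hR₁, hR₃, h₁₂⟩ :=
    exists_constraint_differentials hθ hx hφ hφ'
  have hmem : c.x ∈ c.e.coordSet hab (curvesWithGraphIn n a b P Q A) :=
    ⟨htar, TimeChart.contMDiffOn_curve htar, by rw [hcurve a ha]; exact hγ.2.1,
      by rw [hcurve b hb]; exact hγQ, fun t ht => by rw [hcurve t ht]; exact hγA t ht⟩
  obtain ⟨c', hc'⟩ := c.toStraighteningChart.exists_submersionAt h₁.1 h₂.1 h₃.1 h₁.2 h₂.2 h₃.2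
    hR₁ hR₃ h₁₂ hmem (eventually_mem_coordSet_horizontalCurves hθ hx hφ)
    (eventually_mem_coordSet_curvesWithGraphIn hθ.1 hx hφ hφ') hs
  exact ⟨SubmanifoldChart.ofStraighteningChart c.e c.graph_mem c.x_eq c', hc'⟩

theorem isRegularCurve_of_isSubmersionAtCurve (hP : IsEmbeddedSubmanifold n r P)
    (hQ : IsEmbeddedSubmanifold n s Q)
    (hab : a < b) (hθ : IsAnnihilatorFrame D A θ)
    (hγ : γ ∈ horizontalCurves a b P D) (hγQ : γ b ∈ Q) (hγA : ∀ t ∈ Icc a b, (t, γ t) ∈ A)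
    (hsub : IsSubmersionAtCurve (n := n) hab P Q A (constraintMap a b θ) γ) :
    IsRegularCurve hab P s Q D γ := by
  have ha : a ∈ Icc a b := left_mem_Icc.2 hab.le
  have hb : b ∈ Icc a b := right_mem_Icc.2 hab.le
  obtain ⟨c, hc⟩ := hsub
  have hcurve := curve_eq_of_graph c.graph_mem c.x_eq
  have htar := graph_mem_target c.graph_mem c.x_eq
  have hx : ∀ t : Icc a b, ((t : ℝ), c.x.1.1 t) ∈ c.e.coordOpen A := fun t =>
    c.e.mem_coordOpen.2 ⟨htar t, by
      rw [← c.e.curve_coe, hcurve t t.2]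
      exact hγA t t.2⟩
  obtain ⟨φ, hφ⟩ := hP.2 (γ a) hγ.2.1
  rw [← hcurve a ha] at hφ
  obtain ⟨φ', hφ'⟩ := hQ.2 (γ b) hγQ
  rw [← hcurve b hb] at hφ'
  obtain ⟨L₁, L₂, L₃, R, h₁, h₂, h₃, hR₁, hR₃, h₁₂⟩ :=
    exists_constraint_differentials hθ hx hφ hφ'
  have hmem : c.x ∈ c.e.coordSet hab (horizontalCurves a b P D) :=
    ⟨htar, mem_horizontalCurves_congr hγ hab hcurve⟩
  obtain ⟨c', hc'⟩ := c.toStraighteningChart.exists_surjective_fderiv h₁.1 h₂.1 h₃.1 h₁.2 h₃.2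
    hR₁ hR₃ h₁₂ hmem (eventually_mem_coordSet_curvesWithGraphIn hθ.1 hx hφ hφ')
    (eventually_mem_coordSet_horizontalCurves hθ hx hφ) hc.2.1
  refine ⟨SubmanifoldChart.ofStraighteningChart c.e c.graph_mem c.x_eq c', ?_⟩
  have hbase : c'.param c'.base = c.x := c'.param_base
  refine transverseAt_of_surjective_fderiv
    (c'.contMDiffAt_comp (c.e.contMDiffAt_curve_apply (rightPt hab) (htar _))) (φ := φ') ?_ hc'
  change IsSliceChart s Q (c.e.curve (c'.param c'.base) b) φ'
  rw [hbase]
  exact hφ'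

end Sets

end HorizontalCurves

end

open HorizontalCurves in
theorem proposition3p11 {n k r s : ℕ} {M : Type*} [TopologicalSpace M]
    [ChartedSpace (EuclideanSpace ℝ (Fin n)) M] [IsManifold (𝓡 n) ∞ M]
    [T2Space M] [SecondCountableTopology M]
    (D : ∀ m : M, Submodule ℝ (TangentSpace (𝓡 n) m)) (hD : IsSmoothDistribution k D)
    (P Q : Set M) (hP : IsEmbeddedSubmanifold n r P) (hQ : IsEmbeddedSubmanifold n s Q)
    {a b : ℝ} (hab : a < b)
    (A : Set (ℝ × M)) (θ : Fin (n - k) → ∀ p : ℝ × M, TangentSpace (𝓡 n) p.2 →L[ℝ] ℝ)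
    (hθ : IsAnnihilatorFrame D A θ)
    (γ : ℝ → M) (hγ : γ ∈ horizontalCurves a b P D) (hγQ : γ b ∈ Q)
    (hγA : ∀ t ∈ Icc a b, (t, γ t) ∈ A) :
    IsRegularCurve hab P s Q D γ ↔
      IsSubmersionAtCurve (n := n) hab P Q A (constraintMap a b θ) γ :=
  ⟨isSubmersionAtCurve_of_isRegularCurve hP hab hθ hγ hγQ hγA,
    isRegularCurve_of_isSubmersionAtCurve hP hQ hab hθ hγ hγQ hγA⟩
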